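/- Let $\Omega\subseteq\mathbb R^2$ be a bounded polygonal Lipschitz domain whose boundary is decomposed into a closed Dirichlet part $\Gamma_D\subseteq\partial\Omega$ of positive length and the Neumann part $\Gamma_N:=\partial\Omega\setminus\Gamma_D$. Let $\mathcal T$ be a regular triangulation of $\Omega$, that is, a finite set of nondegenerate closed triangles that cover $\overline\Omega$ and of which any two distinct ones are disjoint or share exactly a common vertex or a common edge. Let $\mathcal E$ be the set of edges of the triangles, let $\mathcal E(\partial\Omega)$ be the set of the edges $E\subseteq\partial\Omega$, and set $\mathcal E(\Omega):=\mathcal E\setminus\mathcal E(\partial\Omega)$, $\mathcal E(\Gamma_D):=\{E\in\mathcal E(\partial\Omega): E\subseteq\Gamma_D\}$ and $\mathcal E(\Gamma_N):=\{E\in\mathcal E(\partial\Omega): E\subseteq\overline{\Gamma_N}\}$. Assume that $\mathcal T$ resolves the decomposition of the boundary in the sense that $\mathcal E(\partial\Omega)$ is the disjoint union of $\mathcal E(\Gamma_D)$ and $\mathcal E(\Gamma_N)$. Let $h_E$ denote the length of an edge $E$, and let $H^1_D(\Omega)$ be the space of all $w\in H^1(\Omega)$ whose trace vanishes on every edge in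 $\mathcal E(\Gamma_D)$. For every $k\in\mathbb N_0$ and every $\theta>0$ there is a constant $C>0$, which depends only on $k$ and $\theta$, with the following property. For all $\Omega$, $\Gamma_D$ and $\mathcal T$ as above such that every interior angle of every triangle in $\mathcal T$ is at least $\theta$, and for every edgewise polynomial $q\in\prod_{E\in\mathcal E}P^k(E)$ of degree at most $k$ (with no continuity between different edges) such that $\int_E q\,ds=0$ for all $E\in\mathcal E(\Omega)\cup\mathcal E(\Gamma_N)$, the supremum $$ S(q):=\sup_{w\in H^1_D(\Omega)\setminus\{0\}}\ \sum_{E\in\mathcal E(\Omega)\cup\mathcal E(\Gamma_N)}\frac{(q,w)_{L^2(E)}}{\|\nabla w\|_{L^2(\Omega)}} $$ is finite, and $$ C^{-1}\Big(\sum_{E\in\mathcal E(\Omega)\cup\mathcal E(\Gamma_N)}h_E\,\|q\|_{L^2(E)}^2\Big)^{1/2}\ \le\ S(q)\ \le\ C\,\Big(\sum_{E\in\mathcal E(\Omega)\cup\mathcal E(\Gamma_N)}h_E\,\|q\|_{L^2(E)}^2\Big)^{1/2}. $$ In particular, the constants do not depend on the size of $\Omega$ or on the mesh size. -/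

import Mathlib

open MeasureTheory Filter Topology
open scoped ContDiff

noncomputable section

/-- The Euclidean plane `ℝ²`. -/
abbrev Plane : Type := EuclideanSpace ℝ (Fin 2)

/-! ## Domains -/

/-- A bounded Lipschitz domain in the plane: a bounded, open, connected (hence nonempty) set which,
near each of its boundary points and in suitably rotated Cartesian coordinates, is the set of points
strictly above the graph of a Lipschitz function. -/
structure IsBoundedLipschitzDomain (Ω : Set Plane) : Prop where
  isOpen : IsOpen Ω
  isConnected : IsConnected Ω
  isBounded : Bornology.IsBounded Ω
  exists_graph : ∀ x ∈ frontier Ω, ∃ r > (0 : ℝ), ∃ e : Plane ≃ₗᵢ[ℝ] Plane, ∃ L : NNReal,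
    ∃ g : ℝ → ℝ, LipschitzWith L g ∧
      ∀ y ∈ Metric.ball x r, (y ∈ Ω ↔ g (e y 0) < e y 1)

/-! ## Regular triangulations -/

/-- The closed convex hull of a finite set of points: the closed triangle (or the closed edge) with
these vertices. -/
def hull (s : Finset Plane) : Set Plane := convexHull ℝ (s : Set Plane)

/-- A regular triangulation of `Ω` into finitely many closed nondegenerate triangles, each given by
its set of three vertices. The triangles cover the closure of `Ω`, and two triangles meet exactly in
the convex hull of their common vertices (nothing, a common vertex or a common edge). -/
structure RegularTriangulation (Ω : Set Plane) where
  triangles : Finset (Finset Plane)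
  card_eq_three : ∀ t ∈ triangles, t.card = 3
  affineIndependent : ∀ t ∈ triangles, AffineIndependent ℝ (Subtype.val : {x // x ∈ t} → Plane)
  hull_inter : ∀ s ∈ triangles, ∀ t ∈ triangles,
    hull s ∩ hull t = convexHull ℝ ((s : Set Plane) ∩ (t : Set Plane))
  cover : ⋃ t ∈ triangles, hull t = closure Ω

namespace RegularTriangulation

variable {Ω : Set Plane}

open Classical in
/-- All edges of all triangles, each given by its set of two endpoints. -/
def edges (T : RegularTriangulation Ω) : Finset (Finset Plane) :=
  T.triangles.biUnion fun t => t.powersetCard 2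

open Classical in
/-- The edges on the boundary of the domain. -/
def boundaryEdges (T : RegularTriangulation Ω) : Finset (Finset Plane) :=
  T.edges.filter fun e => hull e ⊆ frontier Ω

open Classical in
/-- The interior edges: those that do not lie on the boundary. -/
def interiorEdges (T : RegularTriangulation Ω) : Finset (Finset Plane) :=
  T.edges \ T.boundaryEdges

open Classical in
/-- The Dirichlet edges: the boundary edges in `ΓD`. -/
def dirichletEdges (T : RegularTriangulation Ω) (ΓD : Set Plane) : Finset (Finset Plane) :=
  T.boundaryEdges.filter fun e => hull e ⊆ ΓD

open Classical in
/-- The Neumann edges: the boundary edges in the closure of the Neumann part `∂Ω \ ΓD`. -/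
def neumannEdges (T : RegularTriangulation Ω) (ΓD : Set Plane) : Finset (Finset Plane) :=
  T.boundaryEdges.filter fun e => hull e ⊆ closure (frontier Ω \ ΓD)

open Classical in
/-- The interior edges together with the Neumann edges. -/
def freeEdges (T : RegularTriangulation Ω) (ΓD : Set Plane) : Finset (Finset Plane) :=
  T.interiorEdges ∪ T.neumannEdges ΓD

/-- The triangulation resolves the decomposition of the boundary into the Dirichlet part `ΓD` and the
Neumann part `∂Ω \ ΓD`: each boundary edge is either a Dirichlet or a Neumann edge, and not both. -/
def ResolvesBoundary (T : RegularTriangulation Ω) (ΓD : Set Plane) : Prop :=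
  ∀ e ∈ T.boundaryEdges, Xor (e ∈ T.dirichletEdges ΓD) (e ∈ T.neumannEdges ΓD)

/-- All interior angles of all triangles are at least `θ`. -/
def AnglesAtLeast (T : RegularTriangulation Ω) (θ : ℝ) : Prop :=
  ∀ t ∈ T.triangles, ∀ a ∈ t, ∀ b ∈ t, ∀ c ∈ t, a ≠ b → b ≠ c → a ≠ c →
    θ ≤ EuclideanGeometry.angle a b c

end RegularTriangulation

/-! ## The Sobolev space `H¹` and traces -/

/-- `w` belongs to `H¹(U)` and `G` is its weak gradient: both are square integrable on `U`, and
`∫_U w ∂_v φ = - ∫_U φ (G · v)` for all test functions `φ ∈ C_c^∞(U)` and all directions `v`. -/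
structure IsH1 (U : Set Plane) (w : Plane → ℝ) (G : Plane → Plane) : Prop where
  memLp : MemLp w 2 (volume.restrict U)
  memLp_grad : MemLp G 2 (volume.restrict U)
  weak : ∀ φ : Plane → ℝ, ContDiff ℝ ∞ φ → HasCompactSupport φ → tsupport φ ⊆ U → ∀ v : Plane,
    ∫ x in U, w x * fderiv ℝ φ x v = - ∫ x in U, φ x * inner ℝ (G x) v

/-- The arc length measure on the edge with endpoint set `e`. -/
def arc (e : Finset Plane) : Measure Plane :=
  (Measure.hausdorffMeasure 1 : Measure Plane).restrict (hull e)

/-- `g ∈ L²(E)` is the trace, on the edge `E` with endpoint set `e`, of the function `w ∈ H¹(U)` with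
weak gradient `G`. The trace operator is the continuous extension of the restriction of functions
that are smooth up to the boundary: there are smooth functions that converge to `w` in `H¹(U)` and
whose restrictions to `E` converge to `g` in `L²(E)`. -/
def IsTraceFrom (U : Set Plane) (w : Plane → ℝ) (G : Plane → Plane) (e : Finset Plane)
    (g : Plane → ℝ) : Prop :=
  MemLp g 2 (arc e) ∧
  ∃ φ : ℕ → Plane → ℝ, (∀ n, ContDiff ℝ ∞ (φ n)) ∧
    Tendsto (fun n => eLpNorm (fun x => φ n x - w x) 2 (volume.restrict U)) atTop (𝓝 0) ∧
    Tendsto (fun n => eLpNorm (fun x => gradient (φ n) x - G x) 2 (volume.restrict U))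
      atTop (𝓝 0) ∧
    Tendsto (fun n => eLpNorm (fun x => φ n x - g x) 2 (arc e)) atTop (𝓝 0)

namespace RegularTriangulation

variable {Ω : Set Plane}

/-- `g` is the trace of `w ∈ H¹(Ω)` (with weak gradient `G`) on the edge `e`, that is, the trace of
the restriction of `w` to the interior of each triangle that has `e` as an edge. -/
def IsTrace (T : RegularTriangulation Ω) (w : Plane → ℝ) (G : Plane → Plane) (e : Finset Plane)
    (g : Plane → ℝ) : Prop :=
  ∀ t ∈ T.triangles, e ⊆ t → IsTraceFrom (interior (hull t)) w G e g

/-- `w` belongs to `H¹_D(Ω)` and has the weak gradient `G`: it is an `H¹(Ω)` function whose trace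
vanishes on each Dirichlet edge. -/
def IsH1D (T : RegularTriangulation Ω) (ΓD : Set Plane) (w : Plane → ℝ) (G : Plane → Plane) :
    Prop :=
  IsH1 Ω w G ∧ ∀ e ∈ T.dirichletEdges ΓD, T.IsTrace w G e (fun _ => 0)

/-- The set of all quotients `∑_E (q, w)_{L²(E)} / ‖∇w‖_{L²(Ω)}` with `w ∈ H¹_D(Ω) \ {0}`, where `E`
runs through the interior and the Neumann edges, and where `γ e` is the trace of `w` on the edge
`e`. -/
def dualQuotients (T : RegularTriangulation Ω) (ΓD : Set Plane)
    (q : Finset Plane → Plane → ℝ) : Set ℝ :=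
  {r | ∃ (w : Plane → ℝ) (G : Plane → Plane) (γ : Finset Plane → Plane → ℝ),
    T.IsH1D ΓD w G ∧ (¬ w =ᵐ[volume.restrict Ω] 0) ∧
    (∀ e ∈ T.freeEdges ΓD, T.IsTrace w G e (γ e)) ∧
    r = ∑ e ∈ T.freeEdges ΓD,
      (∫ x, q e x * γ e x ∂(arc e)) / Real.sqrt (∫ x in Ω, ‖G x‖ ^ 2)}

/-- The length `h_E` of the edge with endpoint set `e`. -/
def _root_.edgeLength (e : Finset Plane) : ℝ :=
  (Measure.hausdorffMeasure 1 : Measure Plane).real (hull e)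

/-- The weighted norm `(∑_E h_E ‖q‖²_{L²(E)})^{1/2}`, where `E` runs through the interior and the
Neumann edges. -/
def edgeNorm (T : RegularTriangulation Ω) (ΓD : Set Plane) (q : Finset Plane → Plane → ℝ) : ℝ :=
  Real.sqrt (∑ e ∈ T.freeEdges ΓD, edgeLength e * ∫ x, q e x ^ 2 ∂(arc e))

/-- `q` is an edgewise polynomial of degree at most `k`: on each edge it coincides with a polynomial
of total degree at most `k`. No relation between different edges is required. -/
def IsEdgewisePolynomial (T : RegularTriangulation Ω) (k : ℕ) (q : Finset Plane → Plane → ℝ) :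
    Prop :=
  ∀ e ∈ T.edges, ∃ p : MvPolynomial (Fin 2) ℝ, p.totalDegree ≤ k ∧
    ∀ x ∈ hull e, q e x = MvPolynomial.eval (fun i => x i) p

end RegularTriangulation

end

/-!
The upper bound is a sum of local trace estimates. Let `e` be an edge of a triangle `t`, and let
`q` be a polynomial of mean zero on `e`, with antiderivative `Q` vanishing at both endpoints. In
the Duffy coordinates `(s, τ)` of `t`, the divergence theorem for the vector field `(Q φ, (1 - τ)
q φ)` expresses `∫_e q φ` by the gradient of `φ` on `t` alone, since the terms without derivatives
of `φ` cancel and the only flux is the one through `e` (`integral_mul_edge_eq`). With the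
equivalence of norms on polynomials of bounded degree (`exists_sq_eval_le_bubbleSq`) and shape
regularity, this gives `(∫_e q φ)² ≤ C h_e ‖q‖²_e ‖∇φ‖²_t` for smooth `φ` (`sq_integral_arc_le`),
hence for traces of `H¹` functions (`abs_integral_mul_trace_le`). The triangles do not overlap and
have three edges each, so the Cauchy-Schwarz inequality concludes
(`RegularTriangulation.abs_sum_integral_le`).

For the lower bound, the test function is the sum over the free edges `e` of `h_e λ_a λ_b
g_e(λ_b)`, where `λ_a` and `λ_b` are the hat functions at the endpoints of `e` and `g_e` is `q` in
the affine parameter of `e`. On `e` it equals `h_e s (1 - s) q`, so the numerator of the quotient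
is `∑ h_e² ∫_0^1 s (1 - s) g_e(s)² ds`, which is comparable to the square of the weighted norm of
`q`. The energy of the test function has an upper bound of the same form, because `|∇λ| ≤ C / h_e`
and an edge belongs to at most two triangles
(`RegularTriangulation.integral_sq_gradient_edgeBubble_le`). That the test function belongs to
`H¹` follows from integration by parts for Lipschitz functions
(`RegularTriangulation.IsPiecewiseSmooth.isH1`).

All constants depend only on the degree `k` and on a lower bound `σ` for the sines of the angles.
-/

/-! ### Arc length on edges -/

lemma hull_eq_segment {e : Finset Plane} {a b : Plane} (he : (e : Set Plane) = {a, b}) :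
    hull e = segment ℝ a b := by
  rw [hull, he, convexHull_pair]

lemma lineMap_mem_hull {e : Finset Plane} {a b : Plane} (he : (e : Set Plane) = {a, b})
    {s : ℝ} (hs : s ∈ Set.Icc (0 : ℝ) 1) : AffineMap.lineMap a b s ∈ hull e := by
  rw [hull_eq_segment he, segment_eq_image_lineMap]
  exact ⟨s, hs, rfl⟩

lemma edgeLength_eq {e : Finset Plane} {a b : Plane} (he : (e : Set Plane) = {a, b}) :
    edgeLength e = dist a b := by
  rw [edgeLength, hull_eq_segment he, Measure.real, hausdorffMeasure_segment, edist_dist,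
    ENNReal.toReal_ofReal dist_nonneg]

lemma isFiniteMeasure_arc {e : Finset Plane} {a b : Plane} (he : (e : Set Plane) = {a, b}) :
    IsFiniteMeasure (arc e) := by
  constructor
  rw [arc, Measure.restrict_apply_univ, hull_eq_segment he, hausdorffMeasure_segment]
  exact edist_lt_top a b

lemma measurableSet_hull (e : Finset Plane) : MeasurableSet (hull e) :=
  (Set.Finite.isCompact_convexHull (𝕜 := ℝ) e.finite_toSet).isClosed.measurableSet

lemma arc_eq_map {e : Finset Plane} {a b : Plane} (he : (e : Set Plane) = {a, b}) :
    arc e = nndist a b •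
      (volume.restrict (Set.Icc (0 : ℝ) 1)).map (AffineMap.lineMap a b : ℝ → Plane) := by
  have hc : Continuous (AffineMap.lineMap a b : ℝ → Plane) := AffineMap.lineMap_continuous
  ext s hs
  rw [arc, Measure.restrict_apply hs, Measure.smul_apply, Measure.map_apply hc.measurable hs,
    Measure.restrict_apply (hc.measurable hs), hull_eq_segment he, segment_eq_image_lineMap,
    ← Set.image_preimage_inter, hausdorffMeasure_lineMap_image, hausdorffMeasure_real]

lemma integral_arc {e : Finset Plane} {a b : Plane} (he : (e : Set Plane) = {a, b}) (hab : a ≠ b)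
    (f : Plane → ℝ) :
    ∫ x, f x ∂(arc e) = dist a b * ∫ s in (0 : ℝ)..1, f (AffineMap.lineMap a b s) := by
  have hc : Continuous (AffineMap.lineMap a b : ℝ → Plane) := AffineMap.lineMap_continuous
  have hm : MeasurableEmbedding (AffineMap.lineMap a b : ℝ → Plane) :=
    hc.measurableEmbedding (AffineMap.lineMap_injective ℝ hab)
  rw [arc_eq_map he, integral_smul_nnreal_measure, hm.integral_map,
    intervalIntegral.integral_of_le zero_le_one, integral_Icc_eq_integral_Ioc]
  simp [NNReal.smul_def, smul_eq_mul]

/-! ### Equivalence of norms on polynomials of bounded degree -/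

/-- The square of the weighted norm `(∫_0^1 s (1 - s) g(s)² ds)^{1/2}` of a polynomial. -/
noncomputable def bubbleSq (g : Polynomial ℝ) : ℝ :=
  ∫ s in (0 : ℝ)..1, s * (1 - s) * g.eval s ^ 2

lemma bubbleSq_nonneg (g : Polynomial ℝ) : 0 ≤ bubbleSq g := by
  apply intervalIntegral.integral_nonneg zero_le_one
  intro s hs
  have := hs.1
  have := sub_nonneg.2 hs.2
  positivity

lemma bubbleSq_pos {g : Polynomial ℝ} (hg : g ≠ 0) : 0 < bubbleSq g := by
  obtain ⟨c, hc, hgc⟩ : ∃ c ∈ Set.Ioo (0 : ℝ) 1, g.eval c ≠ 0 := by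
    by_contra! h
    apply hg
    refine Polynomial.eq_zero_of_infinite_isRoot g ((Set.Ioo_infinite zero_lt_one).mono ?_)
    intro x hx
    exact h x hx
  refine intervalIntegral.integral_pos zero_lt_one ?_ ?_ ⟨c, Set.Ioo_subset_Icc_self hc, ?_⟩
  · fun_prop
  · intro s hs
    have := hs.1
    have := sub_nonneg.2 hs.2
    positivity
  · have := hc.1
    have := sub_pos.2 hc.2
    positivity

/-- On polynomials of degree at most `k`, the maximum on `[0, 1]` of a polynomial and of its
derivative are controlled by the weighted norm. The weighted norm is positive and continuous on the
compact unit sphere of the coefficient space. -/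
lemma exists_sq_eval_le_bubbleSq (k : ℕ) : ∃ C : ℝ, 1 ≤ C ∧ ∀ g : Polynomial ℝ, g.natDegree ≤ k →
    ∀ s ∈ Set.Icc (0 : ℝ) 1,
      g.eval s ^ 2 ≤ C * bubbleSq g ∧ g.derivative.eval s ^ 2 ≤ C * bubbleSq g := by
  let P : (Fin (k + 1) → ℝ) → Polynomial ℝ := fun c =>
    ∑ i : Fin (k + 1), Polynomial.C (c i) * Polynomial.X ^ (i : ℕ)
  have hPcoeff : ∀ c (i : Fin (k + 1)), (P c).coeff i = c i := by
    intro c i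
    simp only [P, Polynomial.finsetSum_coeff, Polynomial.coeff_C_mul_X_pow]
    rw [Finset.sum_eq_single i]
    · simp
    · intro j _ hj
      rw [if_neg]
      exact fun h => hj (Fin.ext h.symm)
    · simp
  have hPeval : ∀ c s, (P c).eval s = ∑ i : Fin (k + 1), c i * s ^ (i : ℕ) := by
    intro c s
    simp [P, Polynomial.eval_finsetSum]
  have hPder : ∀ c s, (P c).derivative.eval s =
      ∑ i : Fin (k + 1), c i * ((i : ℕ) * s ^ ((i : ℕ) - 1)) := by
    intro c s
    simp [P, Polynomial.eval_finsetSum, Polynomial.derivative_X_pow]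
  have hcont : Continuous fun c => bubbleSq (P c) := by
    unfold bubbleSq
    apply intervalIntegral.continuous_parametric_intervalIntegral_of_continuous'
    simp only [hPeval, Function.uncurry_def]
    fun_prop
  obtain ⟨c₀, hc₀, hmin⟩ := (isCompact_sphere (0 : Fin (k + 1) → ℝ) 1).exists_isMinOn
    (NormedSpace.sphere_nonempty.2 zero_le_one) hcont.continuousOn
  have hm : 0 < bubbleSq (P c₀) := by
    apply bubbleSq_pos
    intro h0
    have : c₀ = 0 := by
      funext i
      rw [← hPcoeff c₀ i, h0]
      simp
    rw [this] at hc₀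
    simp at hc₀
  set m := bubbleSq (P c₀) with hmdef
  have hscale : ∀ (r : ℝ) c, bubbleSq (P (r • c)) = r ^ 2 * bubbleSq (P c) := by
    intro r c
    unfold bubbleSq
    rw [← intervalIntegral.integral_const_mul]
    congr 1
    funext s
    have : (P (r • c)).eval s = r * (P c).eval s := by
      rw [hPeval, hPeval, Finset.mul_sum]
      exact Finset.sum_congr rfl fun i _ => by simp [mul_assoc]
    rw [this]
    ring
  have hcoer : ∀ c, m * ‖c‖ ^ 2 ≤ bubbleSq (P c) := by
    intro c
    by_cases hc : c = 0
    · subst hc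
      simpa using bubbleSq_nonneg (P 0)
    have hn : 0 < ‖c‖ := norm_pos_iff.2 hc
    have h1 : m ≤ bubbleSq (P (‖c‖⁻¹ • c)) := by
      apply hmin
      simp [norm_smul, hn.ne']
    have h2 : c = ‖c‖ • (‖c‖⁻¹ • c) := by
      rw [smul_smul, mul_inv_cancel₀ hn.ne', one_smul]
    calc m * ‖c‖ ^ 2 ≤ bubbleSq (P (‖c‖⁻¹ • c)) * ‖c‖ ^ 2 := by gcongr
      _ = bubbleSq (P c) := by
        conv_rhs => rw [h2, hscale]
        ring
  set A : ℝ := ((k : ℝ) + 1) * ((k : ℝ) + 1) with hA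
  have hA1 : (1 : ℝ) ≤ A := by
    have : (0 : ℝ) ≤ k := Nat.cast_nonneg k
    nlinarith
  refine ⟨max 1 (A ^ 2 / m), le_max_left _ _, ?_⟩
  intro g hg s hs
  have hgP : g = P (fun i => g.coeff i) := by
    conv_lhs => rw [g.as_sum_range_C_mul_X_pow' (Nat.lt_succ_of_le hg)]
    simp only [P]
    rw [Finset.sum_range]
  set c : Fin (k + 1) → ℝ := fun i => g.coeff i with hcdef
  have key : ∀ y : Fin (k + 1) → ℝ, (∀ i, |y i| ≤ (k : ℝ) + 1) →
      (∑ i, c i * y i) ^ 2 ≤ max 1 (A ^ 2 / m) * bubbleSq g := by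
    intro y hy
    have h1 : |∑ i, c i * y i| ≤ A * ‖c‖ := by
      calc |∑ i, c i * y i| ≤ ∑ i, |c i * y i| := Finset.abs_sum_le_sum_abs _ _
        _ ≤ ∑ _i : Fin (k + 1), ‖c‖ * ((k : ℝ) + 1) := by
          apply Finset.sum_le_sum
          intro i _
          rw [abs_mul]
          exact mul_le_mul (norm_le_pi_norm c i) (hy i) (abs_nonneg _) (norm_nonneg _)
        _ = A * ‖c‖ := by
          simp [hA]
          ring
    have h2 : (∑ i, c i * y i) ^ 2 ≤ A ^ 2 * ‖c‖ ^ 2 := by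
      rw [← sq_abs, ← mul_pow]
      exact pow_le_pow_left₀ (abs_nonneg _) h1 2
    have h3 := hcoer c
    rw [← hgP] at h3
    calc (∑ i, c i * y i) ^ 2 ≤ A ^ 2 * ‖c‖ ^ 2 := h2
      _ = (A ^ 2 / m) * (m * ‖c‖ ^ 2) := by
        field_simp
      _ ≤ max 1 (A ^ 2 / m) * bubbleSq g := by
        apply mul_le_mul (le_max_right _ _) h3 (by positivity)
        exact zero_le_one.trans (le_max_left _ _)
  have hpow : ∀ n : ℕ, |s ^ n| ≤ 1 := by
    intro n
    rw [abs_of_nonneg (pow_nonneg hs.1 n)]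
    exact pow_le_one₀ hs.1 hs.2
  constructor
  · have := key (fun i => s ^ (i : ℕ)) (fun i => (hpow i).trans (by simp))
    rwa [← hPeval, ← hgP] at this
  · have := key (fun i => (i : ℕ) * s ^ ((i : ℕ) - 1)) (fun i => by
      rw [abs_mul, Nat.abs_cast]
      have h1 : ((i : ℕ) : ℝ) ≤ (k : ℝ) + 1 := by exact_mod_cast i.2.le
      calc ((i : ℕ) : ℝ) * |s ^ ((i : ℕ) - 1)| ≤ ((k : ℝ) + 1) * 1 :=
            mul_le_mul h1 (hpow _) (abs_nonneg _) (by positivity)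
        _ = _ := mul_one _)
    rwa [← hPder, ← hgP] at this

lemma bubbleSq_le_integral_sq (g : Polynomial ℝ) :
    bubbleSq g ≤ ∫ s in (0 : ℝ)..1, g.eval s ^ 2 := by
  apply intervalIntegral.integral_mono_on zero_le_one
  · exact Continuous.intervalIntegrable (by fun_prop) _ _
  · exact Continuous.intervalIntegrable (by fun_prop) _ _
  · intro s hs
    have h1 := hs.1
    have h2 := hs.2
    have : s * (1 - s) ≤ 1 := by nlinarith
    nlinarith [sq_nonneg (g.eval s)]

/-! ### The Duffy transformation -/

/-- The planar cross product, which is twice the signed area of the triangle spanned by `u` and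
`v`. -/
def cross (u v : Plane) : ℝ := u 0 * v 1 - u 1 * v 0

/-- The Duffy transformation, which collapses the side `τ = 1` of the unit square to the vertex `c`
of the triangle `abc` and maps the side `τ = 0` to the edge `ab`. -/
noncomputable def duffy (a b c : Plane) (p : ℝ × ℝ) : Plane :=
  a + (p.1 * (1 - p.2)) • (b - a) + p.2 • (c - a)

/-- The derivative of the Duffy transformation. -/
noncomputable def duffyDeriv (a b c : Plane) (p : ℝ × ℝ) : ℝ × ℝ →L[ℝ] Plane :=
  ((1 - p.2) • ContinuousLinearMap.fst ℝ ℝ ℝ - p.1 • ContinuousLinearMap.snd ℝ ℝ ℝ).smulRight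
    (b - a) + (ContinuousLinearMap.snd ℝ ℝ ℝ).smulRight (c - a)

lemma hasFDerivAt_duffy (a b c : Plane) (p : ℝ × ℝ) :
    HasFDerivAt (duffy a b c) (duffyDeriv a b c p) p := by
  have h1 : HasFDerivAt (fun p : ℝ × ℝ => p.1 * (1 - p.2))
      ((1 - p.2) • ContinuousLinearMap.fst ℝ ℝ ℝ - p.1 • ContinuousLinearMap.snd ℝ ℝ ℝ) p := by
    convert! (hasFDerivAt_fst (𝕜 := ℝ) (p := p)).mul
      ((hasFDerivAt_snd (𝕜 := ℝ) (p := p)).const_sub 1) using 1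
    ext <;> simp
  exact ((h1.smul_const (b - a)).const_add a).add
    ((hasFDerivAt_snd (𝕜 := ℝ) (p := p)).smul_const (c - a))

lemma continuous_duffy (a b c : Plane) : Continuous (duffy a b c) := by
  unfold duffy
  fun_prop

lemma duffy_mem_convexHull (a b c : Plane) {p : ℝ × ℝ} (h1 : p.1 ∈ Set.Icc (0 : ℝ) 1)
    (h2 : p.2 ∈ Set.Icc (0 : ℝ) 1) : duffy a b c p ∈ convexHull ℝ ({a, b, c} : Set Plane) := by
  have hconv := convex_convexHull ℝ ({a, b, c} : Set Plane)
  have hsub := subset_convexHull ℝ ({a, b, c} : Set Plane)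
  have ha := hsub (show a ∈ ({a, b, c} : Set Plane) by simp)
  have hb := hsub (show b ∈ ({a, b, c} : Set Plane) by simp)
  have hc := hsub (show c ∈ ({a, b, c} : Set Plane) by simp)
  have hab := hconv ha hb (sub_nonneg.2 h1.2) h1.1 (by ring)
  have := hconv hab hc (sub_nonneg.2 h2.2) h2.1 (by ring)
  convert this using 1
  unfold duffy
  module

/-- Integration over the unit square in Duffy coordinates is bounded by integration over the
triangle. -/
lemma integral_comp_duffy_le {a b c : Plane} (hJ : cross (b - a) (c - a) ≠ 0) {F : Plane → ℝ}
    (hF : Continuous F) (hF0 : ∀ x, 0 ≤ F x) :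
    ∫ p in Set.Ioo (0 : ℝ) 1 ×ˢ Set.Ioo (0 : ℝ) 1,
        |(1 - p.2) * cross (b - a) (c - a)| * F (duffy a b c p) ≤
      ∫ x in convexHull ℝ ({a, b, c} : Set Plane), F x := by
  set S := Set.Ioo (0 : ℝ) 1 ×ˢ Set.Ioo (0 : ℝ) 1 with hS
  let E : ℝ × ℝ ≃ᵐ Plane :=
    (MeasurableEquiv.finTwoArrow (α := ℝ)).symm.trans (MeasurableEquiv.toLp 2 (Fin 2 → ℝ))
  have hE : MeasurePreserving E := by
    apply MeasurePreserving.trans (volume_preserving_finTwoArrow ℝ).symm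
    exact (EuclideanSpace.volume_preserving_symm_measurableEquiv_toLp (Fin 2)).symm
  have hEs : ∀ x, E.symm x = (x 0, x 1) := fun x => rfl
  set D : ℝ × ℝ → ℝ × ℝ := fun p => E.symm (duffy a b c p) with hD
  have hED : ∀ p, E (D p) = duffy a b c p := fun p => E.apply_symm_apply _
  set u := b - a with hu
  set v := c - a with hv
  let D' : ℝ × ℝ → ℝ × ℝ →L[ℝ] ℝ × ℝ := fun p =>
    (Matrix.toLin (.finTwoProd ℝ) (.finTwoProd ℝ)
      !![(1 - p.2) * u 0, -p.1 * u 0 + v 0;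
        (1 - p.2) * u 1, -p.1 * u 1 + v 1]).toContinuousLinearMap
  have hdet : ∀ p, (D' p).det = (1 - p.2) * cross u v := by
    intro p
    simp only [D', LinearMap.det_toContinuousLinearMap, LinearMap.det_toLin,
      Matrix.det_fin_two_of, cross]
    ring
  have hD' : ∀ p, HasFDerivAt D (D' p) p := by
    intro p
    have h := hasFDerivAt_duffy a b c p
    have h0 := ((EuclideanSpace.proj (𝕜 := ℝ) (0 : Fin 2)).hasFDerivAt
      (x := duffy a b c p)).comp p h
    have h1 := ((EuclideanSpace.proj (𝕜 := ℝ) (1 : Fin 2)).hasFDerivAt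
      (x := duffy a b c p)).comp p h
    have h2 := h0.prodMk h1
    have h3 : D' p = ((EuclideanSpace.proj (𝕜 := ℝ) (0 : Fin 2)).comp (duffyDeriv a b c p)).prod
        ((EuclideanSpace.proj (𝕜 := ℝ) (1 : Fin 2)).comp (duffyDeriv a b c p)) := by
      simp only [D', Matrix.toLin_finTwoProd_toContinuousLinearMap, duffyDeriv]
      ext <;> simp [hu, hv]
    rw [h3]
    exact h2
  have hinj : Set.InjOn D S := by
    rintro ⟨s, τ⟩ hp ⟨s', τ'⟩ hp' hpp
    have h0 : duffy a b c (s, τ) = duffy a b c (s', τ') := E.symm.injective hpp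
    have h00 := congrArg (fun x : Plane => x 0) h0
    have h01 := congrArg (fun x : Plane => x 1) h0
    simp only [duffy, PiLp.add_apply, PiLp.smul_apply, smul_eq_mul, ← hu, ← hv] at h00 h01
    have e1 : (s * (1 - τ) - s' * (1 - τ')) * cross u v = 0 := by
      simp only [cross]
      linear_combination v 1 * h00 - v 0 * h01
    have e2 : (τ - τ') * cross u v = 0 := by
      simp only [cross]
      linear_combination u 0 * h01 - u 1 * h00
    have e2' : τ = τ' := sub_eq_zero.1 ((mul_eq_zero.1 e2).resolve_right hJ)
    have e1' := (mul_eq_zero.1 e1).resolve_right hJ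
    subst e2'
    have hτ : 1 - τ ≠ 0 := (sub_pos.2 hp.2.2).ne'
    have : (s - s') * (1 - τ) = 0 := by linear_combination e1'
    have := sub_eq_zero.1 ((mul_eq_zero.1 this).resolve_right hτ)
    rw [this]
  have hSm : MeasurableSet S := measurableSet_Ioo.prod measurableSet_Ioo
  have hcv := integral_image_eq_integral_abs_det_fderiv_smul volume hSm
    (fun p _ => (hD' p).hasFDerivWithinAt) hinj (fun y => F (E y))
  simp only [hdet, hED, smul_eq_mul] at hcv
  rw [← hcv]
  set H := convexHull ℝ ({a, b, c} : Set Plane) with hH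
  have hHc : IsCompact H := Set.Finite.isCompact_convexHull (𝕜 := ℝ) (by simp)
  rw [← hE.setIntegral_preimage_emb E.measurableEmbedding F H]
  apply setIntegral_mono_set
  · have : IntegrableOn F H := hF.continuousOn.integrableOn_compact hHc
    exact (hE.integrableOn_comp_preimage E.measurableEmbedding).2 this
  · exact Eventually.of_forall fun y => hF0 _
  · apply LE.le.eventuallyLE
    rintro _ ⟨p, hp, rfl⟩
    rw [Set.mem_preimage, hED]
    exact duffy_mem_convexHull a b c (Set.Ioo_subset_Icc_self hp.1) (Set.Ioo_subset_Icc_self hp.2)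

/-! ### A trace estimate for functionals of mean zero -/

/-- The divergence theorem for the vector field `(Q φ, (1 - τ) Q' φ)` in Duffy coordinates. The
terms without derivatives of `φ` cancel, and the field has no flux through the sides `s = 0`,
`s = 1` and `τ = 1`. -/
lemma integral_mul_edge_eq (a b c : Plane) {φ : Plane → ℝ} (hφ : ContDiff ℝ ∞ φ)
    {Q : Polynomial ℝ} (hQ0 : Q.eval 0 = 0) (hQ1 : Q.eval 1 = 0) :
    ∫ s in (0 : ℝ)..1, Q.derivative.eval s * φ (AffineMap.lineMap a b s) =
      -∫ p in Set.Icc ((0 : ℝ), (0 : ℝ)) (1, 1), (1 - p.2) * fderiv ℝ φ (duffy a b c p)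
        (Q.eval p.1 • (b - a) + Q.derivative.eval p.1 • ((c - a) - p.1 • (b - a))) := by
  have hdφ : ∀ x, HasFDerivAt φ (fderiv ℝ φ x) x := fun x =>
    (hφ.differentiable (by simp) x).hasFDerivAt
  have hφD : ∀ p, HasFDerivAt (fun p => φ (duffy a b c p))
      ((fderiv ℝ φ (duffy a b c p)).comp (duffyDeriv a b c p)) p := fun p =>
    (hdφ _).comp p (hasFDerivAt_duffy a b c p)
  have hpoly : ∀ (R : Polynomial ℝ) (p : ℝ × ℝ), HasFDerivAt (fun p : ℝ × ℝ => R.eval p.1)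
      (R.derivative.eval p.1 • ContinuousLinearMap.fst ℝ ℝ ℝ) p := fun R p =>
    (R.hasDerivAt p.1).comp_hasFDerivAt p hasFDerivAt_fst
  have hf := fun p => (hpoly Q p).mul (hφD p)
  have hg := fun p => ((((hasFDerivAt_snd (𝕜 := ℝ) (p := p)).const_sub (1 : ℝ)).mul
    (hpoly Q.derivative p)).mul (hφD p))
  have hcf : Continuous fun x => fderiv ℝ φ x := hφ.continuous_fderiv (by simp)
  have hcD := continuous_duffy a b c
  have hcomp : ∀ p : ℝ × ℝ,
      (1 - p.2) * fderiv ℝ φ (duffy a b c p)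
        (Q.eval p.1 • (b - a) + Q.derivative.eval p.1 • ((c - a) - p.1 • (b - a))) =
      (Q.eval p.1 • (fderiv ℝ φ (duffy a b c p)).comp (duffyDeriv a b c p) +
          φ (duffy a b c p) • Q.derivative.eval p.1 • ContinuousLinearMap.fst ℝ ℝ ℝ) (1, 0) +
        (((1 - p.2) * Q.derivative.eval p.1) •
            (fderiv ℝ φ (duffy a b c p)).comp (duffyDeriv a b c p) +
          φ (duffy a b c p) • ((1 - p.2) • Q.derivative.derivative.eval p.1 •
            ContinuousLinearMap.fst ℝ ℝ ℝ +
            Q.derivative.eval p.1 • -ContinuousLinearMap.snd ℝ ℝ ℝ)) (0, 1) := by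
    intro p
    simp only [duffyDeriv, add_apply, smul_apply,
      ContinuousLinearMap.comp_apply, ContinuousLinearMap.smulRight_apply,
      sub_apply, neg_apply,
      ContinuousLinearMap.coe_fst', ContinuousLinearMap.coe_snd', map_add, map_sub, map_smul,
      smul_eq_mul]
    ring
  have hcont : Continuous fun p : ℝ × ℝ => (1 - p.2) * fderiv ℝ φ (duffy a b c p)
        (Q.eval p.1 • (b - a) + Q.derivative.eval p.1 • ((c - a) - p.1 • (b - a))) := by
    have : Continuous fun p : ℝ × ℝ => fderiv ℝ φ (duffy a b c p)
        (Q.eval p.1 • (b - a) + Q.derivative.eval p.1 • ((c - a) - p.1 • (b - a))) :=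
      (hcf.comp hcD).clm_apply (by fun_prop)
    fun_prop
  have hdiv := integral_divergence_prod_Icc_of_hasFDerivAt_of_le _ _ _ _ ((0 : ℝ), (0 : ℝ)) (1, 1)
    (by simp [Prod.le_def]) (fun p _ => (hf p).continuousAt.continuousWithinAt)
    (fun p _ => (hg p).continuousAt.continuousWithinAt) (fun p _ => hf p) (fun p _ => hg p)
    (by
      simp only [Pi.mul_apply, ← hcomp]
      exact hcont.continuousOn.integrableOn_compact isCompact_Icc)
  simp only [Pi.mul_apply, ← hcomp] at hdiv
  rw [hdiv]
  have h0 : ∀ s : ℝ, duffy a b c (s, 0) = AffineMap.lineMap a b s := by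
    intro s
    simp only [duffy, AffineMap.lineMap_apply, vsub_eq_sub, vadd_eq_add]
    module
  simp [hQ0, hQ1, h0]

lemma sq_integral_le {α : Type*} [MeasurableSpace α] {μ : Measure α} [IsProbabilityMeasure μ]
    {f : α → ℝ} (hf : Integrable f μ) (hf2 : Integrable (fun x => f x ^ 2) μ) :
    (∫ x, f x ∂μ) ^ 2 ≤ ∫ x, f x ^ 2 ∂μ := by
  have h : 0 ≤ ∫ x, (f x - ∫ y, f y ∂μ) ^ 2 ∂μ := integral_nonneg fun x => sq_nonneg _
  have h2 : ∫ x, (f x - ∫ y, f y ∂μ) ^ 2 ∂μ =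
      ∫ x, f x ^ 2 - (2 * ∫ y, f y ∂μ) * f x + (∫ y, f y ∂μ) ^ 2 ∂μ := by
    congr 1
    funext x
    ring
  rw [h2, integral_add (show Integrable (fun x => f x ^ 2 - (2 * ∫ y, f y ∂μ) * f x) μ from
      hf2.sub (hf.const_mul _)) (integrable_const _),
    integral_sub hf2 (hf.const_mul _), integral_const_mul, integral_const] at h
  simp only [probReal_univ, one_smul] at h
  nlinarith

/-- The trace estimate on a triangle: a polynomial functional of mean zero on an edge, applied to a
smooth function, is controlled by the gradient of the function on the triangle. -/
lemma sq_integral_mul_edge_le {a b c : Plane} (hJ : cross (b - a) (c - a) ≠ 0) {d M : ℝ}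
    (hd1 : ‖b - a‖ ≤ d) (hd2 : ‖c - a‖ ≤ d) (hd3 : ‖c - b‖ ≤ d)
    {φ : Plane → ℝ} (hφ : ContDiff ℝ ∞ φ)
    {Q : Polynomial ℝ} (hQ0 : Q.eval 0 = 0) (hQ1 : Q.eval 1 = 0)
    (hM : ∀ s ∈ Set.Icc (0 : ℝ) 1, |Q.eval s| ≤ M)
    (hM' : ∀ s ∈ Set.Icc (0 : ℝ) 1, |Q.derivative.eval s| ≤ M) :
    (∫ s in (0 : ℝ)..1, Q.derivative.eval s * φ (AffineMap.lineMap a b s)) ^ 2 ≤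
      (2 * M * d) ^ 2 / |cross (b - a) (c - a)| *
        ∫ x in convexHull ℝ ({a, b, c} : Set Plane), ‖gradient φ x‖ ^ 2 := by
  have hgrad : ∀ x, ‖gradient φ x‖ = ‖fderiv ℝ φ x‖ := fun x => by simp [gradient]
  simp only [hgrad]
  have hM0 : 0 ≤ M := (abs_nonneg _).trans (hM 0 (by simp))
  have hd0 : 0 ≤ d := (norm_nonneg _).trans hd1
  rw [integral_mul_edge_eq a b c hφ hQ0 hQ1, neg_sq]
  have hcf : Continuous fun x => fderiv ℝ φ x := hφ.continuous_fderiv (by simp)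
  have hcD := continuous_duffy a b c
  set w : ℝ → Plane := fun s =>
    Q.eval s • (b - a) + Q.derivative.eval s • ((c - a) - s • (b - a)) with hw
  have hwc : Continuous w := by fun_prop
  have hwb : ∀ s ∈ Set.Icc (0 : ℝ) 1, ‖w s‖ ≤ 2 * M * d := by
    intro s hs
    have h1 : (c - a) - s • (b - a) = (1 - s) • (c - a) + s • (c - b) := by module
    have h2 : ‖(c - a) - s • (b - a)‖ ≤ d := by
      rw [h1]
      refine (norm_add_le _ _).trans ?_
      rw [norm_smul, norm_smul, Real.norm_of_nonneg hs.1, Real.norm_of_nonneg (sub_nonneg.2 hs.2)]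
      nlinarith [mul_le_mul_of_nonneg_left hd2 (sub_nonneg.2 hs.2),
        mul_le_mul_of_nonneg_left hd3 hs.1]
    calc ‖w s‖ ≤ ‖Q.eval s • (b - a)‖ + ‖Q.derivative.eval s • ((c - a) - s • (b - a))‖ :=
          norm_add_le _ _
      _ ≤ M * d + M * d := by
        rw [norm_smul, norm_smul]
        exact add_le_add (mul_le_mul (hM s hs) hd1 (norm_nonneg _) hM0)
          (mul_le_mul (hM' s hs) h2 (norm_nonneg _) hM0)
      _ = _ := by ring
  set Y : ℝ × ℝ → ℝ := fun p => (1 - p.2) * fderiv ℝ φ (duffy a b c p) (w p.1) with hY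
  have hYc : Continuous Y := by
    have : Continuous fun p : ℝ × ℝ => fderiv ℝ φ (duffy a b c p) (w p.1) :=
      (hcf.comp hcD).clm_apply (hwc.comp continuous_fst)
    fun_prop
  set I := Set.Icc ((0 : ℝ), (0 : ℝ)) (1, 1) with hI
  have hIprod : I = Set.Icc (0 : ℝ) 1 ×ˢ Set.Icc (0 : ℝ) 1 := by
    rw [hI, Set.Icc_prod_eq]
  have hprob : IsProbabilityMeasure (volume.restrict I) := by
    constructor
    rw [Measure.restrict_apply_univ, hIprod, Measure.volume_eq_prod, Measure.prod_prod]
    simp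
  have hint : ∀ f : ℝ × ℝ → ℝ, Continuous f → IntegrableOn f I := fun f hf =>
    hf.continuousOn.integrableOn_compact isCompact_Icc
  have hcs := sq_integral_le (hint Y hYc) (hint _ (hYc.pow 2))
  refine hcs.trans ?_
  set F : Plane → ℝ := fun x => ‖fderiv ℝ φ x‖ ^ 2 with hF
  have hFc : Continuous F := by fun_prop
  have hJ' : 0 < |cross (b - a) (c - a)| := abs_pos.2 hJ
  have hduffy := integral_comp_duffy_le hJ hFc (fun x => sq_nonneg _)
  have hae : (Set.Ioo (0 : ℝ) 1 ×ˢ Set.Ioo (0 : ℝ) 1 : Set (ℝ × ℝ)) =ᵐ[volume] I := by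
    rw [hIprod]
    exact Measure.set_prod_ae_eq Ioo_ae_eq_Icc Ioo_ae_eq_Icc
  rw [setIntegral_congr_set hae] at hduffy
  calc ∫ p in I, Y p ^ 2
      ≤ ∫ p in I, (2 * M * d) ^ 2 / |cross (b - a) (c - a)| *
          (|(1 - p.2) * cross (b - a) (c - a)| * F (duffy a b c p)) := by
        apply setIntegral_mono_on (hint _ (hYc.pow 2)) _ measurableSet_Icc
        · intro p hp
          rw [hIprod] at hp
          have hp2 := hp.2
          have hb := hwb p.1 hp.1
          have h1 : |fderiv ℝ φ (duffy a b c p) (w p.1)| ≤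
              ‖fderiv ℝ φ (duffy a b c p)‖ * (2 * M * d) :=
            ((fderiv ℝ φ (duffy a b c p)).le_opNorm _).trans
              (mul_le_mul_of_nonneg_left hb (norm_nonneg _))
          have h2 : (fderiv ℝ φ (duffy a b c p) (w p.1)) ^ 2 ≤
              F (duffy a b c p) * (2 * M * d) ^ 2 := by
            rw [← sq_abs, hF, ← mul_pow]
            exact pow_le_pow_left₀ (abs_nonneg _) h1 2
          have h3 : (1 - p.2) ^ 2 ≤ 1 - p.2 := by nlinarith [hp2.1, hp2.2]
          rw [abs_mul, abs_of_nonneg (sub_nonneg.2 hp2.2), hY]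
          calc ((1 - p.2) * fderiv ℝ φ (duffy a b c p) (w p.1)) ^ 2
              = (1 - p.2) ^ 2 * (fderiv ℝ φ (duffy a b c p) (w p.1)) ^ 2 := by ring
            _ ≤ (1 - p.2) * (F (duffy a b c p) * (2 * M * d) ^ 2) :=
              mul_le_mul h3 h2 (sq_nonneg _) (sub_nonneg.2 hp2.2)
            _ = _ := by field_simp
        · exact hint _ (by fun_prop)
    _ = (2 * M * d) ^ 2 / |cross (b - a) (c - a)| *
          ∫ p in I, |(1 - p.2) * cross (b - a) (c - a)| * F (duffy a b c p) :=
        integral_const_mul _ _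
    _ ≤ _ := by gcongr

/-! ### Shape regularity of triangles -/

/-- A triangle is shape regular with parameter `σ` if the sine of each of its angles is at least
`σ`, expressed without angles. -/
def ShapeRegular (σ : ℝ) (t : Finset Plane) : Prop :=
  ∀ a ∈ t, ∀ b ∈ t, ∀ c ∈ t, a ≠ b → b ≠ c → a ≠ c →
    σ * (dist a b * dist c b) ≤ |cross (a - b) (c - b)|

lemma cross_sq (u v : Plane) : cross u v ^ 2 = ‖u‖ ^ 2 * ‖v‖ ^ 2 - inner ℝ u v ^ 2 := by
  simp only [EuclideanSpace.norm_sq_eq, PiLp.inner_apply, Fin.sum_univ_two, cross,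
    Real.norm_eq_abs, sq_abs, RCLike.inner_apply, conj_trivial]
  ring

lemma abs_cross_le (u v : Plane) : |cross u v| ≤ ‖u‖ * ‖v‖ := by
  apply abs_le_of_sq_le_sq _ (by positivity)
  rw [cross_sq, mul_pow]
  nlinarith [sq_nonneg (inner ℝ u v)]

lemma abs_cross_eq_sin_mul (u v : Plane) :
    |cross u v| = Real.sin (InnerProductGeometry.angle u v) * (‖u‖ * ‖v‖) := by
  rw [InnerProductGeometry.sin_angle_mul_norm_mul_norm, ← Real.sqrt_sq_eq_abs, cross_sq,
    real_inner_self_eq_norm_sq, real_inner_self_eq_norm_sq, sq (inner ℝ u v)]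

/-- If all angles of a triangle are at least `θ`, they are also at most `π - θ`, so their sines are
at least `sin θ`. -/
lemma shapeRegular_of_angle {θ : ℝ} (h0 : 0 < θ) {t : Finset Plane}
    (h : ∀ a ∈ t, ∀ b ∈ t, ∀ c ∈ t, a ≠ b → b ≠ c → a ≠ c →
      θ ≤ EuclideanGeometry.angle a b c) : ShapeRegular (Real.sin θ) t := by
  intro a ha b hb c hc hab hbc hac
  rw [abs_cross_eq_sin_mul, dist_eq_norm, dist_eq_norm]
  apply mul_le_mul_of_nonneg_right _ (by positivity)
  have hs := EuclideanGeometry.angle_add_angle_add_angle_eq_pi c hab.symm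
  have e1 := h a ha b hb c hc hab hbc hac
  have e2 := h b hb c hc a ha hbc hac.symm hab.symm
  change Real.sin θ ≤ Real.sin (EuclideanGeometry.angle a b c)
  set x := EuclideanGeometry.angle a b c
  have e3 : 0 ≤ EuclideanGeometry.angle c a b := EuclideanGeometry.angle_nonneg _ _ _
  have hpi := Real.pi_gt_three
  rcases le_total x (Real.pi / 2) with hx | hx
  · exact Real.sin_le_sin_of_le_of_le_pi_div_two (by linarith) hx e1
  · rw [← Real.sin_pi_sub x]
    exact Real.sin_le_sin_of_le_of_le_pi_div_two (by linarith) (by linarith) (by linarith)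

lemma ShapeRegular.mul_dist_le {σ : ℝ} {t : Finset Plane} (h : ShapeRegular σ t) {a b c : Plane}
    (ha : a ∈ t) (hb : b ∈ t) (hc : c ∈ t) (hab : a ≠ b) (hbc : b ≠ c) (hac : a ≠ c) :
    σ * dist c a ≤ dist a b := by
  have h1 := h a ha c hc b hb hac hbc.symm hab
  have h2 : |cross (a - c) (b - c)| ≤ dist a b * dist c b := by
    have : cross (a - c) (b - c) = cross (a - b) (b - c) := by
      simp only [cross, PiLp.sub_apply]
      ring
    rw [this, dist_comm c b, dist_eq_norm, dist_eq_norm]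
    exact abs_cross_le _ _
  have h3 : 0 < dist c b := dist_pos.2 hbc.symm
  rw [dist_comm b c, dist_comm a c] at h1
  nlinarith

lemma ShapeRegular.sq_mul_sq_dist_le {σ : ℝ} (hσ : 0 < σ) {t : Finset Plane}
    (h : ShapeRegular σ t) {a b c : Plane}
    (ha : a ∈ t) (hb : b ∈ t) (hc : c ∈ t) (hab : a ≠ b) (hbc : b ≠ c) (hac : a ≠ c) :
    σ ^ 2 * dist a b ^ 2 ≤ |cross (b - a) (c - a)| := by
  have h1 := h b hb a ha c hc hab.symm hac hbc
  have h2 := h.mul_dist_le hc ha hb hac.symm hab hbc.symm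
  rw [dist_comm b a] at h1
  rw [dist_comm b c] at h2
  have h3 : σ * dist a b ≤ dist c a := by
    have := h.mul_dist_le ha hc hb hac hbc.symm hab
    rwa [dist_comm b a, dist_comm a c] at this
  have h4 : 0 ≤ dist a b := dist_nonneg
  nlinarith [mul_le_mul_of_nonneg_left h3 (mul_nonneg hσ.le h4)]

/-! ### Barycentric coordinates -/

/-- Cramer's rule in the plane. -/
lemma cross_smul_eq (u v w : Plane) : cross u v • w = cross w v • u + cross u w • v := by
  ext i
  fin_cases i <;> simp [cross] <;> ring

/-- Barycentric coordinate of the triangle `t` at the vertex `v`: the affine function that is `1`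
at `v` and `0` at all other vertices. It vanishes at all vertices of `t` if `v` is not a vertex. -/
noncomputable def coord (t : Finset Plane) (v : Plane) : Plane →ᵃ[ℝ] ℝ :=
  open Classical in
  if h : ∃ f : Plane →ᵃ[ℝ] ℝ, ∀ w ∈ t, f w = if v = w then 1 else 0 then h.choose else 0

open Classical in
lemma coord_apply {t : Finset Plane} (h3 : t.card = 3)
    (hi : AffineIndependent ℝ (Subtype.val : {x // x ∈ t} → Plane)) (v : Plane) {w : Plane}
    (hw : w ∈ t) : coord t v w = if v = w then 1 else 0 := by
  have h : ∃ f : Plane →ᵃ[ℝ] ℝ, ∀ w ∈ t, f w = if v = w then 1 else 0 := by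
    by_cases hv : v ∈ t
    · have hspan : affineSpan ℝ (Set.range (Subtype.val : {x // x ∈ t} → Plane)) = ⊤ := by
        rw [hi.affineSpan_eq_top_iff_card_eq_finrank_add_one]
        simp [h3]
      let B : AffineBasis {x // x ∈ t} ℝ Plane := ⟨Subtype.val, hi, hspan⟩
      refine ⟨B.coord ⟨v, hv⟩, fun w hw => ?_⟩
      have := B.coord_apply ⟨v, hv⟩ ⟨w, hw⟩
      change B.coord ⟨v, hv⟩ w = _ at this
      simpa [Subtype.ext_iff] using this
    · refine ⟨0, fun w hw => ?_⟩
      rw [if_neg (fun h : v = w => hv (h ▸ hw))]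
      rfl
  rw [coord, dif_pos h]
  exact h.choose_spec w hw

lemma coord_mem_Icc {t : Finset Plane} (h3 : t.card = 3)
    (hi : AffineIndependent ℝ (Subtype.val : {x // x ∈ t} → Plane)) (v : Plane) {x : Plane}
    (hx : x ∈ hull t) : coord t v x ∈ Set.Icc (0 : ℝ) 1 := by
  have : hull t ⊆ coord t v ⁻¹' Set.Icc (0 : ℝ) 1 := by
    apply convexHull_min _ ((convex_Icc 0 1).affine_preimage _)
    intro w hw
    rw [Set.mem_preimage, coord_apply h3 hi v hw]
    split_ifs <;> simp
  exact this hx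

lemma AffineMap.eqOn_convexHull {f g : Plane →ᵃ[ℝ] ℝ} {s : Set Plane} (h : Set.EqOn f g s) :
    Set.EqOn f g (convexHull ℝ s) := by
  have : convexHull ℝ s ⊆ (f - g) ⁻¹' {0} := by
    apply convexHull_min _ ((convex_singleton 0).affine_preimage _)
    intro w hw
    simp [h hw]
  intro x hx
  simpa [sub_eq_zero] using this hx

/-- The linear part of an affine function as a continuous linear map. -/
noncomputable def AffineMap.slope (f : Plane →ᵃ[ℝ] ℝ) : Plane →L[ℝ] ℝ :=
  LinearMap.toContinuousLinearMap f.linear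

lemma AffineMap.slope_sub (f : Plane →ᵃ[ℝ] ℝ) (x y : Plane) : f.slope (x - y) = f x - f y := by
  simp [AffineMap.slope, ← vsub_eq_sub, AffineMap.linearMap_vsub]

lemma AffineMap.eq_slope_add (f : Plane →ᵃ[ℝ] ℝ) : (f : Plane → ℝ) = fun x => f.slope x + f 0 := by
  funext x
  have := f.slope_sub x 0
  rw [sub_zero] at this
  rw [this]
  ring

lemma AffineMap.hasFDerivAt_slope (f : Plane →ᵃ[ℝ] ℝ) (x : Plane) : HasFDerivAt f f.slope x := by
  have := f.slope.hasFDerivAt (x := x) |>.add_const (f 0)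
  rwa [← f.eq_slope_add] at this

lemma AffineMap.contDiff_plane (f : Plane →ᵃ[ℝ] ℝ) : ContDiff ℝ ∞ f := by
  rw [f.eq_slope_add]
  exact f.slope.contDiff.add contDiff_const

/-- The gradient of a barycentric coordinate is at most the inverse of the height. -/
lemma norm_slope_coord_le {σ : ℝ} (hσ : 0 < σ) {t : Finset Plane} (h3 : t.card = 3)
    (hi : AffineIndependent ℝ (Subtype.val : {x // x ∈ t} → Plane)) (hs : ShapeRegular σ t)
    {a b : Plane} (ha : a ∈ t) (hb : b ∈ t) (hab : a ≠ b) :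
    ‖(coord t a).slope‖ ≤ (σ * dist a b)⁻¹ := by
  classical
  obtain ⟨c, hc, hca, hcb⟩ : ∃ c ∈ t, c ≠ a ∧ c ≠ b := by
    obtain ⟨c, hc⟩ := Finset.exists_mem_notMem_of_card_lt_card (s := {a, b}) (t := t)
      (by rw [h3, Finset.card_pair hab]; norm_num)
    simp only [Finset.mem_insert, Finset.mem_singleton, not_or] at hc
    exact ⟨c, hc.1, hc.2.1, hc.2.2⟩
  have hd : 0 < dist a b := dist_pos.2 hab
  have hd' : 0 < dist c b := dist_pos.2 hcb
  have hL1 : (coord t a).slope (a - b) = 1 := by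
    rw [AffineMap.slope_sub, coord_apply h3 hi a ha, coord_apply h3 hi a hb]
    simp [hab]
  have hL2 : (coord t a).slope (c - b) = 0 := by
    rw [AffineMap.slope_sub, coord_apply h3 hi a hc, coord_apply h3 hi a hb]
    simp [hab, hca.symm]
  have hJ := hs a ha b hb c hc hab hcb.symm hca.symm
  apply ContinuousLinearMap.opNorm_le_bound _ (by positivity)
  intro w
  have h1 := congrArg (coord t a).slope (cross_smul_eq (a - b) (c - b) w)
  simp only [map_add, map_smul, hL1, hL2, smul_eq_mul, mul_one, mul_zero, add_zero] at h1
  have h2 : |cross (a - b) (c - b)| * ‖(coord t a).slope w‖ ≤ ‖w‖ * dist c b := by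
    rw [Real.norm_eq_abs, ← abs_mul, h1, dist_eq_norm]
    exact abs_cross_le _ _
  rw [inv_mul_eq_div, le_div_iff₀ (by positivity)]
  have h4 : 0 ≤ ‖(coord t a).slope w‖ := norm_nonneg _
  have h5 : σ * (dist a b * dist c b) * ‖(coord t a).slope w‖ ≤ ‖w‖ * dist c b :=
    (mul_le_mul_of_nonneg_right hJ h4).trans h2
  have h6 : (‖(coord t a).slope w‖ * (σ * dist a b)) * dist c b ≤ ‖w‖ * dist c b := by linarith
  exact le_of_mul_le_mul_right h6 hd'

/-! ### Lipschitz functions on finite closed covers -/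

/-- A function that is Lipschitz on each set of a finite closed cover of a segment is Lipschitz
along the segment. -/
lemma abs_sub_le_of_segment_cover {ι : Type*} (I : Finset ι) (A : ι → Set Plane)
    (hA : ∀ i ∈ I, IsClosed (A i)) {w : Plane → ℝ} {L : ℝ}
    (hw : ∀ i ∈ I, ∀ x ∈ A i, ∀ y ∈ A i, |w x - w y| ≤ L * dist x y) {y z : Plane}
    (hcov : segment ℝ y z ⊆ ⋃ i ∈ I, A i) : |w z - w y| ≤ L * dist z y := by
  set l : ℝ → Plane := fun s => AffineMap.lineMap y z s with hl
  have hlc : Continuous l := AffineMap.lineMap_continuous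
  have hdist : ∀ s s', dist (l s) (l s') = |s - s'| * dist y z := fun s s' => by
    simp [hl, dist_lineMap_lineMap, Real.dist_eq]
  have hcov' : ∀ s ∈ Set.Icc (0 : ℝ) 1, ∃ i ∈ I, l s ∈ A i := by
    intro s hs
    have : l s ∈ segment ℝ y z := by
      rw [segment_eq_image_lineMap]
      exact ⟨s, hs, rfl⟩
    simpa using hcov this
  set S : Set ℝ := {s | |w (l s) - w (l 0)| ≤ L * (s * dist y z)} with hS
  have hclosed : IsClosed (S ∩ Set.Icc 0 1) := by
    have hU : S ∩ Set.Icc 0 1 = ⋃ i ∈ I, ((l ⁻¹' A i ∩ Set.Icc 0 1) ∩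
        (fun s => |w (l s) - w (l 0)| - L * (s * dist y z)) ⁻¹' Set.Iic 0) := by
      ext s
      simp only [hS, Set.mem_inter_iff, Set.mem_ofPred_eq, Set.mem_iUnion, Set.mem_preimage,
        Set.mem_Iic, sub_nonpos, exists_prop]
      constructor
      · rintro ⟨h1, h2⟩
        obtain ⟨i, hi, hsi⟩ := hcov' s h2
        exact ⟨i, hi, ⟨hsi, h2⟩, h1⟩
      · rintro ⟨i, -, ⟨-, h2⟩, h1⟩
        exact ⟨h1, h2⟩
    rw [hU]
    apply I.finite_toSet.isClosed_biUnion
    intro i hi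
    have hcl : IsClosed (l ⁻¹' A i ∩ Set.Icc 0 1) := ((hA i hi).preimage hlc).inter isClosed_Icc
    apply ContinuousOn.preimage_isClosed_of_isClosed _ hcl isClosed_Iic
    have hwc : ContinuousOn (fun s => w (l s)) (l ⁻¹' A i ∩ Set.Icc 0 1) := by
      apply LipschitzOnWith.continuousOn (K := (L * dist y z).toNNReal)
      apply LipschitzOnWith.of_dist_le_mul
      intro s hs s' hs'
      rw [Real.dist_eq, Real.dist_eq]
      refine (hw i hi _ hs.1 _ hs'.1).trans ?_
      rw [hdist]
      calc L * (|s - s'| * dist y z) = (L * dist y z) * |s - s'| := by ring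
        _ ≤ _ := mul_le_mul_of_nonneg_right (Real.le_coe_toNNReal _) (abs_nonneg _)
    exact (hwc.sub continuousOn_const).abs.sub (by fun_prop)
  have h1 : (1 : ℝ) ∈ S := by
    apply hclosed.mem_of_ge_of_forall_exists_gt _ zero_le_one
    · intro s hs
      by_contra hne
      have hev : ∀ i ∈ I, ∀ᶠ s' in 𝓝[>] s, l s' ∉ A i := by
        intro i hi
        by_cases hsi : l s ∈ A i
        · filter_upwards [Ioc_mem_nhdsGT hs.2.2] with s' hs' hmem
          refine hne ⟨s', ?_, hs'⟩
          have e1 := hw i hi _ hmem _ hsi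
          rw [hdist, abs_of_pos (sub_pos.2 hs'.1)] at e1
          have e2 : |w (l s) - w (l 0)| ≤ L * (s * dist y z) := hs.1
          have e3 := abs_sub_le (w (l s')) (w (l s)) (w (l 0))
          change |w (l s') - w (l 0)| ≤ L * (s' * dist y z)
          linarith
        · have : (l ⁻¹' A i)ᶜ ∈ 𝓝 s := ((hA i hi).preimage hlc).isOpen_compl.mem_nhds hsi
          exact nhdsWithin_le_nhds this
      have hall := (eventually_all_finset I).2 hev
      obtain ⟨s', hs', hs''⟩ := (hall.and (Ioc_mem_nhdsGT hs.2.2)).exists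
      obtain ⟨i, hi, hmem⟩ := hcov' s' ⟨hs.2.1.trans hs''.1.le, hs''.2⟩
      exact hs' i hi hmem
    · simp [hS]
  have : |w (l 1) - w (l 0)| ≤ L * (1 * dist y z) := h1
  simpa [hl, dist_comm] using this

/-! ### Geometry of the triangulation -/

/-- A Lipschitz domain lies on one side of its boundary, so it is the interior of its closure: the
points right below a boundary point, in local coordinates, are not in the closure. -/
lemma IsBoundedLipschitzDomain.interior_closure {Ω : Set Plane} (h : IsBoundedLipschitzDomain Ω) :
    interior (closure Ω) = Ω := by
  apply Set.Subset.antisymm _ (h.isOpen.subset_interior_closure)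
  intro x hx
  by_contra hxΩ
  have hxf : x ∈ frontier Ω := by
    rw [frontier, h.isOpen.interior_eq]
    exact ⟨interior_subset hx, hxΩ⟩
  obtain ⟨r, hr, e, L, g, hg, hgr⟩ := h.exists_graph x hxf
  have hx0 : e x 1 ≤ g (e x 0) := by
    have := (hgr x (Metric.mem_ball_self hr)).not.1 hxΩ
    exact not_lt.1 this
  set y : ℝ → Plane := fun s => x - s • e.symm (EuclideanSpace.single 1 1) with hy
  have hyc : Continuous y := by fun_prop
  have hy0 : y 0 = x := by simp [hy]
  have hev : ∀ᶠ s in 𝓝[>] (0 : ℝ), y s ∈ closure Ω ∩ Metric.ball x r := by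
    apply nhdsWithin_le_nhds
    apply hyc.continuousAt.preimage_mem_nhds
    rw [hy0]
    exact inter_mem (mem_interior_iff_mem_nhds.1 hx) (Metric.ball_mem_nhds x hr)
  obtain ⟨s, ⟨hs1, hs2⟩, hs0⟩ := (hev.and self_mem_nhdsWithin).exists
  have hs0 : 0 < s := hs0
  -- A whole neighbourhood of `y s` lies strictly below the graph.
  have hbelow : ∀ᶠ z in 𝓝 (y s), z ∈ Metric.ball x r ∧ e z 1 < g (e z 0) := by
    refine Filter.Eventually.and (Metric.isOpen_ball.mem_nhds hs2) ?_
    have hc : ∀ i, Continuous fun z => e z i := fun i =>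
      (EuclideanSpace.proj (𝕜 := ℝ) i).continuous.comp e.continuous
    have hopen : IsOpen {z : Plane | e z 1 < g (e z 0)} :=
      isOpen_lt (hc 1) (hg.continuous.comp (hc 0))
    apply hopen.mem_nhds
    simp only [hy, Set.mem_ofPred_eq, map_sub, map_smul, LinearIsometryEquiv.apply_symm_apply,
      PiLp.sub_apply, PiLp.smul_apply, smul_eq_mul]
    simp
    linarith
  obtain ⟨z, hz, hzΩ⟩ := (mem_closure_iff_nhds.1 hs1) _ hbelow
  exact absurd ((hgr z hz.1).1 hzΩ) (not_lt.2 hz.2.le)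

lemma isCompact_hull (e : Finset Plane) : IsCompact (hull e) :=
  Set.Finite.isCompact_convexHull (𝕜 := ℝ) e.finite_toSet

lemma isClosed_hull (e : Finset Plane) : IsClosed (hull e) := (isCompact_hull e).isClosed

lemma convex_hull (e : Finset Plane) : Convex ℝ (hull e) := convex_convexHull ℝ _

lemma hull_mono {e t : Finset Plane} (h : e ⊆ t) : hull e ⊆ hull t :=
  convexHull_mono (by exact_mod_cast h)

lemma interior_hull_ae_eq (t : Finset Plane) : interior (hull t) =ᵐ[volume] hull t :=
  interior_ae_eq_of_null_frontier ((convex_hull t).addHaar_frontier volume)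

lemma volume_hull_eq_zero {u : Finset Plane} (hu : u.card ≤ 2) : volume (hull u) = 0 := by
  classical
  obtain ⟨u', huu, hu'⟩ := Infinite.exists_superset_card_eq u 2 hu
  obtain ⟨a, b, -, rfl⟩ := Finset.card_eq_two.1 hu'
  apply measure_mono_null ((hull_mono huu).trans (convexHull_subset_affineSpan _))
  apply Measure.addHaar_affineSubspace
  intro htop
  have h1 := (collinear_iff_finrank_le_one (k := ℝ)).1 (collinear_pair ℝ a b)
  have h2 : vectorSpan ℝ ({a, b} : Set Plane) = ⊤ := by
    rw [← direction_affineSpan]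
    have : affineSpan ℝ ({a, b} : Set Plane) = ⊤ := by
      convert! htop using 2
      simp
    rw [this, AffineSubspace.direction_top]
  rw [h2, finrank_top, finrank_euclideanSpace_fin] at h1
  norm_num at h1

namespace RegularTriangulation

variable {Ω : Set Plane} (T : RegularTriangulation Ω)

lemma hull_subset_closure {t : Finset Plane} (ht : t ∈ T.triangles) : hull t ⊆ closure Ω := by
  rw [← T.cover]
  exact Set.subset_biUnion_of_mem (u := fun t => hull t) (by exact_mod_cast ht)

lemma interior_hull_subset (hΩ : IsBoundedLipschitzDomain Ω) {t : Finset Plane}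
    (ht : t ∈ T.triangles) : interior (hull t) ⊆ Ω := by
  rw [← hΩ.interior_closure]
  exact interior_mono (T.hull_subset_closure ht)

lemma exists_mem_hull {x : Plane} (hx : x ∈ closure Ω) : ∃ t ∈ T.triangles, x ∈ hull t := by
  rw [← T.cover] at hx
  simpa using hx

lemma disjoint_interior {s t : Finset Plane} (hs : s ∈ T.triangles) (ht : t ∈ T.triangles)
    (hst : s ≠ t) : Disjoint (interior (hull s)) (interior (hull t)) := by
  classical
  rw [Set.disjoint_iff_inter_eq_empty]
  apply (isOpen_interior.inter isOpen_interior).eq_empty_of_measure_zero (μ := volume)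
  have hsub : interior (hull s) ∩ interior (hull t) ⊆ hull (s ∩ t) := by
    refine (Set.inter_subset_inter interior_subset interior_subset).trans ?_
    rw [T.hull_inter s hs t ht, hull]
    simp
  apply measure_mono_null hsub
  apply volume_hull_eq_zero
  by_contra hcard
  have h1 : s ∩ t = s := Finset.eq_of_subset_of_card_le Finset.inter_subset_left
    (by rw [T.card_eq_three s hs]; omega)
  have h2 : s ∩ t = t := Finset.eq_of_subset_of_card_le Finset.inter_subset_right
    (by rw [T.card_eq_three t ht]; omega)
  exact hst (h1.symm.trans h2)

lemma ae_eq_biUnion (hΩ : IsBoundedLipschitzDomain Ω) :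
    Ω =ᵐ[volume] ⋃ t ∈ T.triangles, interior (hull t) := by
  have h1 : (⋃ t ∈ T.triangles, interior (hull t)) =ᵐ[volume] ⋃ t ∈ T.triangles, hull t := by
    have := Filter.EventuallyEq.countable_bUnion (l := ae (volume : Measure Plane))
      (S := (T.triangles : Set (Finset Plane))) T.triangles.finite_toSet.countable
      (s := fun t _ => interior (hull t)) (t := fun t _ => hull t)
      (fun t _ => interior_hull_ae_eq t)
    simpa using this
  have h2 : (⋃ t ∈ T.triangles, interior (hull t)) ⊆ Ω :=
    Set.iUnion₂_subset fun t ht => T.interior_hull_subset hΩ ht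
  have h3 : Ω ⊆ ⋃ t ∈ T.triangles, hull t := by
    rw [T.cover]
    exact subset_closure
  apply EventuallyLE.antisymm
  · exact (LE.le.eventuallyLE h3).trans h1.symm.le
  · exact LE.le.eventuallyLE h2

lemma ae_mem_interior (hΩ : IsBoundedLipschitzDomain Ω) :
    ∀ᵐ x ∂(volume.restrict Ω), ∃ t ∈ T.triangles, x ∈ interior (hull t) := by
  rw [Measure.restrict_congr_set (T.ae_eq_biUnion hΩ)]
  have hm : MeasurableSet (⋃ t ∈ T.triangles, interior (hull t)) :=
    T.triangles.measurableSet_biUnion fun t _ => isOpen_interior.measurableSet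
  filter_upwards [ae_restrict_mem hm] with x hx
  simpa using hx

lemma setIntegral_eq_sum (hΩ : IsBoundedLipschitzDomain Ω) {f : Plane → ℝ}
    (hf : IntegrableOn f Ω) :
    ∫ x in Ω, f x = ∑ t ∈ T.triangles, ∫ x in interior (hull t), f x := by
  rw [setIntegral_congr_set (T.ae_eq_biUnion hΩ)]
  apply integral_biUnion_finset
  · exact fun t _ => isOpen_interior.measurableSet
  · exact fun s hs t ht hst => T.disjoint_interior hs ht hst
  · exact fun t ht => hf.mono_set (T.interior_hull_subset hΩ ht)

/-! ### Edges -/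

lemma exists_triangle_of_edge {e : Finset Plane} (he : e ∈ T.edges) :
    ∃ t ∈ T.triangles, e ⊆ t ∧ e.card = 2 := by
  classical
  simp only [edges, Finset.mem_biUnion, Finset.mem_powersetCard] at he
  obtain ⟨t, ht, h⟩ := he
  exact ⟨t, ht, h⟩

lemma freeEdges_subset_edges (ΓD : Set Plane) : T.freeEdges ΓD ⊆ T.edges := by
  classical
  intro e he
  simp only [freeEdges, Finset.mem_union, interiorEdges, neumannEdges, boundaryEdges,
    Finset.mem_sdiff, Finset.mem_filter] at he
  rcases he with h | h
  · exact h.1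
  · exact h.1.1

lemma dirichletEdges_subset_edges (ΓD : Set Plane) : T.dirichletEdges ΓD ⊆ T.edges := by
  classical
  intro e he
  simp only [dirichletEdges, boundaryEdges, Finset.mem_filter] at he
  exact he.1.1

lemma notMem_freeEdges_of_mem_dirichletEdges {ΓD : Set Plane} (h : T.ResolvesBoundary ΓD)
    {e : Finset Plane} (he : e ∈ T.dirichletEdges ΓD) : e ∉ T.freeEdges ΓD := by
  classical
  have hb : e ∈ T.boundaryEdges := by
    simp only [dirichletEdges, Finset.mem_filter] at he
    exact he.1
  intro hf
  simp only [freeEdges, Finset.mem_union, interiorEdges, Finset.mem_sdiff] at hf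
  rcases hf with h1 | h1
  · exact h1.2 hb
  · rcases h e hb with h2 | h2
    · exact h2.2 h1
    · exact h2.2 he

lemma exists_third_vertex {t : Finset Plane} (ht : t ∈ T.triangles) {e : Finset Plane}
    (het : e ⊆ t) {a b : Plane} (hab : a ≠ b) (he : (e : Set Plane) = {a, b}) :
    ∃ c, (t : Set Plane) = {a, b, c} ∧ c ≠ a ∧ c ≠ b := by
  classical
  have he' : e = {a, b} := by
    apply Finset.coe_injective
    simpa using he
  subst he'
  obtain ⟨c, hc, hc'⟩ := Finset.exists_mem_notMem_of_card_lt_card (s := {a, b}) (t := t)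
    (by rw [T.card_eq_three t ht, Finset.card_pair hab]; norm_num)
  simp only [Finset.mem_insert, Finset.mem_singleton, not_or] at hc'
  refine ⟨c, ?_, hc'.1, hc'.2⟩
  have h3 : ({a, b, c} : Finset Plane).card = 3 :=
    Finset.card_eq_three.2 ⟨a, b, c, hab, Ne.symm hc'.1, Ne.symm hc'.2, rfl⟩
  have : ({a, b, c} : Finset Plane) = t := by
    apply Finset.eq_of_subset_of_card_le
    · intro x hx
      simp only [Finset.mem_insert, Finset.mem_singleton] at hx
      rcases hx with rfl | rfl | rfl
      · exact het (by simp)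
      · exact het (by simp)
      · exact hc
    · rw [T.card_eq_three t ht, h3]
  rw [← this]
  simp

lemma cross_ne_zero {t : Finset Plane} (ht : t ∈ T.triangles) {a b c : Plane}
    (htc : (t : Set Plane) = {a, b, c}) (hca : c ≠ a) (hcb : c ≠ b) :
    cross (b - a) (c - a) ≠ 0 := by
  classical
  intro h0
  have ha : a ∈ t := by rw [← Finset.mem_coe, htc]; simp
  have hb : b ∈ t := by rw [← Finset.mem_coe, htc]; simp
  have hc : c ∈ t := by rw [← Finset.mem_coe, htc]; simp
  have hL := fun v w (hw : w ∈ t) =>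
    coord_apply (T.card_eq_three t ht) (T.affineIndependent t ht) v hw
  -- Cramer's rule with a vanishing determinant, evaluated by the coordinate at `c`.
  have hab : a ≠ b := by
    rintro rfl
    have : t = {a, c} := by
      apply Finset.coe_injective
      simp [htc]
    have h3 := T.card_eq_three t ht
    rw [this] at h3
    have := Finset.card_le_two (a := a) (b := c)
    omega
  have h1 : ∀ w, cross w (c - a) * (coord t c).slope (b - a) +
      cross (b - a) w * (coord t c).slope (c - a) = 0 := by
    intro w
    have := congrArg (coord t c).slope (cross_smul_eq (b - a) (c - a) w)
    simpa [h0] using this.symm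
  have hs1 : (coord t c).slope (b - a) = 0 := by
    rw [AffineMap.slope_sub, hL c b hb, hL c a ha]
    simp [hca, hcb]
  have hs2 : (coord t c).slope (c - a) = 1 := by
    rw [AffineMap.slope_sub, hL c c hc, hL c a ha]
    simp [hca]
  simp only [hs1, hs2, mul_zero, zero_add, mul_one] at h1
  have e0 := h1 (EuclideanSpace.single 0 1)
  have e1 := h1 (EuclideanSpace.single 1 1)
  simp [cross] at e0 e1
  apply hab
  ext i
  fin_cases i
  · simp; linarith
  · simp; linarith

/-- Two triangles on the same side of a common edge overlap near the midpoint of the edge. -/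
lemma exists_mem_overlap {a b c c' : Plane}
    (h : 0 < cross (b - a) (c - a) * cross (b - a) (c' - a)) :
    ∃ x ∈ convexHull ℝ ({a, b, c} : Set Plane) ∩ convexHull ℝ ({a, b, c'} : Set Plane),
      cross (b - a) (x - a) ≠ 0 := by
  set J := cross (b - a) (c - a) with hJ
  have hJ0 : J ≠ 0 := left_ne_zero_of_mul h.ne'
  set β := cross (c' - a) (c - a) / J with hβ
  set γ := cross (b - a) (c' - a) / J with hγ
  have hγ0 : 0 < γ := by
    rw [hγ, div_eq_mul_inv]
    have : cross (b - a) (c' - a) * J⁻¹ = J * cross (b - a) (c' - a) * (J⁻¹) ^ 2 := by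
      field_simp
    rw [this]
    positivity
  have hc' : c' - a = β • (b - a) + γ • (c - a) := by
    have := cross_smul_eq (b - a) (c - a) (c' - a)
    have h2 := congrArg (fun z => J⁻¹ • z) this
    simp only [smul_add, smul_smul, ← hJ, inv_mul_cancel₀ hJ0, one_smul] at h2
    rw [h2, hβ, hγ]
    simp only [div_eq_inv_mul]
  set ε := 1 / (4 * (1 + |β| + γ)) with hε
  have hβ0 : 0 ≤ |β| := abs_nonneg β
  have hD : 0 < 4 * (1 + |β| + γ) := by positivity
  have hε0 : 0 < ε := by positivity
  have hεD : ε * (1 + |β| + γ) = 1 / 4 := by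
    rw [hε]
    field_simp
  have hε1 : ε ≤ 1 / 4 := by nlinarith
  have hεβ : |ε * β| ≤ 1 / 4 := by
    rw [abs_mul, abs_of_pos hε0]
    nlinarith
  have hεγ : ε * γ ≤ 1 / 4 := by nlinarith
  obtain ⟨hεβ1, hεβ2⟩ := abs_le.1 hεβ
  have hmem : ∀ (z : Plane) (p q r : ℝ), 0 ≤ p → 0 ≤ q → 0 ≤ r → p + q + r = 1 →
      p • a + q • b + r • z ∈ convexHull ℝ ({a, b, z} : Set Plane) := by
    intro z p q r hp hq hr hsum
    have hconv := convex_convexHull ℝ ({a, b, z} : Set Plane)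
    have hsub := subset_convexHull ℝ ({a, b, z} : Set Plane)
    have := hconv.sum_mem (t := Finset.univ) (w := ![p, q, r]) (z := ![a, b, z])
      (by intro i _; fin_cases i <;> simpa) (by simpa [Fin.sum_univ_three] using hsum)
      (by intro i _; fin_cases i <;> exact hsub (by simp))
    simpa [Fin.sum_univ_three] using this
  refine ⟨((1 - ε) / 2) • a + ((1 - ε) / 2) • b + ε • c', ⟨?_, ?_⟩, ?_⟩
  · have hx : ((1 - ε) / 2) • a + ((1 - ε) / 2) • b + ε • c' =
        (1 - ((1 - ε) / 2 + ε * β) - ε * γ) • a + ((1 - ε) / 2 + ε * β) • b + (ε * γ) • c := by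
      have : c' = a + β • (b - a) + γ • (c - a) := by rw [add_assoc, ← hc']; abel
      rw [this]
      module
    rw [hx]
    apply hmem
    · linarith
    · linarith
    · positivity
    · ring
  · apply hmem
    · linarith
    · linarith
    · exact hε0.le
    · ring
  · have hx : cross (b - a) (((1 - ε) / 2) • a + ((1 - ε) / 2) • b + ε • c' - a) =
        ε * cross (b - a) (c' - a) := by
      simp only [cross, PiLp.sub_apply, PiLp.add_apply, PiLp.smul_apply, smul_eq_mul]
      ring
    rw [hx]
    exact mul_ne_zero hε0.ne' (right_ne_zero_of_mul h.ne')

open Classical in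
/-- An edge belongs to at most two triangles, one on each side. -/
lemma card_filter_edge_subset_le {e : Finset Plane} (he2 : e.card = 2) :
    (T.triangles.filter fun t => e ⊆ t).card ≤ 2 := by
  by_contra! hcard
  obtain ⟨t₁, h₁, t₂, h₂, t₃, h₃, h₁₂, h₁₃, h₂₃⟩ := Finset.two_lt_card.1 hcard
  simp only [Finset.mem_filter] at h₁ h₂ h₃
  obtain ⟨a, b, hab, rfl⟩ := Finset.card_eq_two.1 he2
  have he : (({a, b} : Finset Plane) : Set Plane) = {a, b} := by simp
  have key : ∀ s ∈ T.triangles, ∀ t ∈ T.triangles, s ≠ t → ∀ c c', (s : Set Plane) = {a, b, c} →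
      (t : Set Plane) = {a, b, c'} → cross (b - a) (c - a) * cross (b - a) (c' - a) ≤ 0 := by
    intro s hs t ht hst c c' hsc htc
    by_contra! hpos
    obtain ⟨x, hx, hx0⟩ := exists_mem_overlap hpos
    have hcc : c ≠ c' := by
      rintro rfl
      exact hst (Finset.coe_injective (hsc.trans htc.symm))
    have hinter := T.hull_inter s hs t ht
    rw [hull, hull, hsc, htc] at hinter
    rw [hinter] at hx
    have hzero : ∀ y ∈ ({a, b, c} : Set Plane) ∩ {a, b, c'}, cross (b - a) (y - a) = 0 := by
      rintro y ⟨h1, h2⟩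
      have : y = a ∨ y = b := by
        simp only [Set.mem_insert_iff, Set.mem_singleton_iff] at h1 h2
        rcases h1 with h | h | h
        · exact Or.inl h
        · exact Or.inr h
        · rcases h2 with h' | h' | h'
          · exact Or.inl h'
          · exact Or.inr h'
          · exact absurd (h.symm.trans h') hcc
      rcases this with rfl | rfl
      · simp [cross]
      · simp [cross, mul_comm]
    have hconv : Convex ℝ {y : Plane | cross (b - a) (y - a) = 0} := by
      intro y hy z hz p q _ _ hpq
      simp only [Set.mem_ofPred_eq] at hy hz ⊢
      have hexp : cross (b - a) (p • y + q • z - a) =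
          p * cross (b - a) (y - a) + q * cross (b - a) (z - a) := by
        have hq : q = 1 - p := by linarith
        subst hq
        simp only [cross, PiLp.sub_apply, PiLp.add_apply, PiLp.smul_apply, smul_eq_mul]
        ring
      rw [hexp, hy, hz]
      simp
    exact hx0 (convexHull_min hzero hconv hx)
  obtain ⟨c₁, hc₁, h1a, h1b⟩ := T.exists_third_vertex h₁.1 h₁.2 hab he
  obtain ⟨c₂, hc₂, h2a, h2b⟩ := T.exists_third_vertex h₂.1 h₂.2 hab he
  obtain ⟨c₃, hc₃, h3a, h3b⟩ := T.exists_third_vertex h₃.1 h₃.2 hab he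
  have n₁ := T.cross_ne_zero h₁.1 hc₁ h1a h1b
  have n₂ := T.cross_ne_zero h₂.1 hc₂ h2a h2b
  have n₃ := T.cross_ne_zero h₃.1 hc₃ h3a h3b
  have k₁₂ := key t₁ h₁.1 t₂ h₂.1 h₁₂ _ _ hc₁ hc₂
  have k₁₃ := key t₁ h₁.1 t₃ h₃.1 h₁₃ _ _ hc₁ hc₃
  have k₂₃ := key t₂ h₂.1 t₃ h₃.1 h₂₃ _ _ hc₂ hc₃
  rcases lt_or_gt_of_ne n₁ with m₁ | m₁ <;> rcases lt_or_gt_of_ne n₂ with m₂ | m₂ <;>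
    rcases lt_or_gt_of_ne n₃ with m₃ | m₃ <;> nlinarith

end RegularTriangulation

/-! ### Gradients and traces of continuous functions -/

lemma continuous_gradient {f : Plane → ℝ} (hf : ContDiff ℝ ∞ f) : Continuous (gradient f) :=
  (InnerProductSpace.toDual ℝ Plane).symm.continuous.comp (hf.continuous_fderiv (by simp))

lemma inner_gradient {f : Plane → ℝ} (x v : Plane) : inner ℝ (gradient f x) v = fderiv ℝ f x v := by
  simp [gradient]

lemma norm_gradient (f : Plane → ℝ) (x : Plane) : ‖gradient f x‖ = ‖fderiv ℝ f x‖ := by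
  simp [gradient]

lemma measurable_gradient (f : Plane → ℝ) : Measurable (gradient f) :=
  (InnerProductSpace.toDual ℝ Plane).symm.continuous.measurable.comp (measurable_fderiv ℝ f)

lemma memLp_arc {e : Finset Plane} (he : e.card = 2) {f : Plane → ℝ} {p : ENNReal}
    (hf : ContinuousOn f (hull e)) : MemLp f p (arc e) := by
  classical
  obtain ⟨a, b, -, hab⟩ := Finset.card_eq_two.1 he
  have := isFiniteMeasure_arc (e := e) (a := a) (b := b) (by simp [hab])
  obtain ⟨C, hC⟩ := (isCompact_hull e).exists_bound_of_continuousOn hf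
  have hm : AEStronglyMeasurable f (arc e) := hf.aestronglyMeasurable (measurableSet_hull e)
  apply MemLp.of_bound hm C
  filter_upwards [(ae_restrict_mem (measurableSet_hull e) : ∀ᵐ x ∂(arc e), x ∈ hull e)] with x hx
  exact hC x hx

/-! ### Piecewise smooth functions -/

namespace RegularTriangulation

variable {Ω : Set Plane} (T : RegularTriangulation Ω)

/-- `w` coincides with a smooth function on each closed triangle of the triangulation. In
particular, it is continuous across the edges. -/
def IsPiecewiseSmooth (w : Plane → ℝ) (φ : Finset Plane → Plane → ℝ) : Prop :=
  ∀ t ∈ T.triangles, ContDiff ℝ ∞ (φ t) ∧ Set.EqOn w (φ t) (hull t)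

variable {T} {w : Plane → ℝ} {φ : Finset Plane → Plane → ℝ}

lemma IsPiecewiseSmooth.eventuallyEq (h : T.IsPiecewiseSmooth w φ) {t : Finset Plane}
    (ht : t ∈ T.triangles) {x : Plane} (hx : x ∈ interior (hull t)) : w =ᶠ[𝓝 x] φ t := by
  filter_upwards [isOpen_interior.mem_nhds hx] with y hy
  exact (h t ht).2 (interior_subset hy)

lemma IsPiecewiseSmooth.gradient_eq (h : T.IsPiecewiseSmooth w φ) {t : Finset Plane}
    (ht : t ∈ T.triangles) {x : Plane} (hx : x ∈ interior (hull t)) :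
    gradient w x = gradient (φ t) x := by
  rw [gradient, gradient, (h.eventuallyEq ht hx).fderiv_eq]

lemma IsPiecewiseSmooth.continuousOn (h : T.IsPiecewiseSmooth w φ) :
    ContinuousOn w (closure Ω) := by
  have hcov : closure Ω = ⋃ t : T.triangles, hull t.1 := by
    rw [← T.cover, Set.iUnion_subtype]
  rw [hcov]
  apply LocallyFinite.continuousOn_iUnion (locallyFinite_of_finite _)
  · exact fun t => isClosed_hull t.1
  · exact fun t => (h t.1 t.2).1.continuous.continuousOn.congr (h t.1 t.2).2

/-- A piecewise smooth function is Lipschitz on compact subsets of the domain. -/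
lemma IsPiecewiseSmooth.exists_lipschitzOnWith (h : T.IsPiecewiseSmooth w φ) (hΩ : IsOpen Ω)
    {K : Set Plane} (hK : IsCompact K) (hKΩ : K ⊆ Ω) : ∃ L, LipschitzOnWith L w K := by
  have hL : ∀ t ∈ T.triangles, ∃ L : NNReal, LipschitzOnWith L w (hull t) := by
    intro t ht
    obtain ⟨L, hL⟩ := ((h t ht).1.of_le (by simp) :
      ContDiff ℝ 1 (φ t)).locallyLipschitz.locallyLipschitzOn.exists_lipschitzOnWith_of_compact
        (s := hull t) (isCompact_hull t)
    refine ⟨L, fun x hx y hy => ?_⟩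
    rw [(h t ht).2 hx, (h t ht).2 hy]
    exact hL hx hy
  choose! L hL using hL
  set M : NNReal := ∑ t ∈ T.triangles, L t with hM
  apply LocallyLipschitzOn.exists_lipschitzOnWith_of_compact hK
  intro x hx
  obtain ⟨r, hr, hball⟩ := Metric.isOpen_iff.1 hΩ x (hKΩ hx)
  refine ⟨M, Metric.ball x r ∩ K, ?_, ?_⟩
  · rw [Set.inter_comm]
    exact inter_mem self_mem_nhdsWithin (nhdsWithin_le_nhds (Metric.ball_mem_nhds x hr))
  · apply LipschitzOnWith.of_dist_le_mul
    intro z hz y hy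
    rw [Real.dist_eq]
    apply abs_sub_le_of_segment_cover T.triangles hull (fun t _ => isClosed_hull t)
    · intro t ht p hp q hq
      have := (hL t ht).dist_le_mul p hp q hq
      rw [Real.dist_eq] at this
      refine this.trans (mul_le_mul_of_nonneg_right ?_ dist_nonneg)
      exact_mod_cast Finset.single_le_sum (f := L) (fun _ _ => zero_le) ht
    · rw [T.cover]
      exact ((convex_ball x r).segment_subset hy.1 hz.1).trans (hball.trans subset_closure)

/-- Continuous piecewise smooth functions belong to `H¹`, with the piecewise gradient as weak
gradient. Near the support of a test function, such a function is Lipschitz, so that integration by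
parts for Lipschitz functions applies. -/
lemma IsPiecewiseSmooth.isH1 (h : T.IsPiecewiseSmooth w φ) (hΩ : IsBoundedLipschitzDomain Ω) :
    IsH1 Ω w (gradient w) := by
  have hfin : IsFiniteMeasure (volume.restrict Ω) :=
    ⟨by rw [Measure.restrict_apply_univ]; exact hΩ.isBounded.measure_lt_top⟩
  have hΩc : IsCompact (closure Ω) := hΩ.isBounded.isCompact_closure
  refine ⟨?_, ?_, ?_⟩
  · obtain ⟨C, hC⟩ := hΩc.exists_bound_of_continuousOn h.continuousOn
    apply MemLp.of_bound ((h.continuousOn.mono subset_closure).aestronglyMeasurable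
      hΩ.isOpen.measurableSet) C
    filter_upwards [ae_restrict_mem hΩ.isOpen.measurableSet] with x hx
    exact hC x (subset_closure hx)
  · have hb : ∀ t ∈ T.triangles, ∃ C : ℝ, ∀ x ∈ hull t, ‖gradient (φ t) x‖ ≤ C := fun t ht =>
      (isCompact_hull t).exists_bound_of_continuousOn (continuous_gradient (h t ht).1).continuousOn
    choose! C hC using hb
    apply MemLp.of_bound (measurable_gradient w).aestronglyMeasurable
      (∑ t ∈ T.triangles, |C t|)
    filter_upwards [T.ae_mem_interior hΩ] with x hx
    obtain ⟨t, ht, hxt⟩ := hx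
    rw [h.gradient_eq ht hxt]
    exact (hC t ht x (interior_subset hxt)).trans ((le_abs_self _).trans
      (Finset.single_le_sum (f := fun t => |C t|) (fun _ _ => abs_nonneg _) ht))
  · intro ψ hψ hψc hψΩ v
    obtain ⟨K, hK, hψK, hKΩ⟩ := exists_compact_between hψc.isCompact hΩ.isOpen hψΩ
    obtain ⟨L, hL⟩ := h.exists_lipschitzOnWith hΩ.isOpen hK hKΩ
    obtain ⟨f, hf, hfw⟩ := hL.extend_real
    obtain ⟨D, hD⟩ := ContDiff.lipschitzWith_of_hasCompactSupport hψc hψ (by simp)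
    have hparts := LipschitzWith.integral_lineDeriv_mul_eq (μ := volume) hf hD hψc v
    have hψd : ∀ x, lineDeriv ℝ ψ x (-v) = -fderiv ℝ ψ x v := by
      intro x
      rw [(hψ.differentiable (by simp) x).lineDeriv_eq_fderiv, map_neg]
    have hψ0 : ∀ x, x ∉ tsupport ψ → ψ x = 0 := fun x hx => image_eq_zero_of_notMem_tsupport hx
    have hψ0' : ∀ x, x ∉ tsupport ψ → fderiv ℝ ψ x v = 0 := fun x hx => by
      have : x ∉ tsupport (fderiv ℝ ψ) := fun hx' => hx (tsupport_fderiv_subset ℝ hx')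
      rw [image_eq_zero_of_notMem_tsupport this]
      simp
    have e1 : ∫ x, lineDeriv ℝ ψ x (-v) * f x = -∫ x in Ω, w x * fderiv ℝ ψ x v := by
      rw [← setIntegral_eq_integral_of_forall_compl_eq_zero (s := Ω), ← integral_neg]
      · apply setIntegral_congr_fun hΩ.isOpen.measurableSet
        intro x _
        change lineDeriv ℝ ψ x (-v) * f x = -(w x * fderiv ℝ ψ x v)
        rw [hψd]
        by_cases hx : x ∈ tsupport ψ
        · rw [hfw (interior_subset (hψK hx))]
          ring
        · rw [hψ0' x hx]
          ring
      · intro x hx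
        rw [hψd, hψ0' x (fun h' => hx (hψΩ h'))]
        ring
    have e2 : ∫ x, lineDeriv ℝ f x v * ψ x = ∫ x in Ω, ψ x * inner ℝ (gradient w x) v := by
      rw [← setIntegral_eq_integral_of_forall_compl_eq_zero (s := Ω)]
      · apply integral_congr_ae
        filter_upwards [T.ae_mem_interior hΩ] with x hx
        obtain ⟨t, ht, hxt⟩ := hx
        by_cases hxs : x ∈ tsupport ψ
        · have hfw' : f =ᶠ[𝓝 x] w := by
            filter_upwards [isOpen_interior.mem_nhds (hψK hxs)] with y hy
            exact (hfw (interior_subset hy)).symm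
          have hwd : DifferentiableAt ℝ w x :=
            ((h t ht).1.differentiable (by simp) x).congr_of_eventuallyEq (h.eventuallyEq ht hxt)
          rw [(hwd.congr_of_eventuallyEq hfw').lineDeriv_eq_fderiv, hfw'.fderiv_eq,
            inner_gradient, mul_comm]
        · rw [hψ0 x hxs]
          ring
      · intro x hx
        rw [hψ0 x (fun h' => hx (hψΩ h'))]
        ring
    rw [e1, e2] at hparts
    linarith

/-- The traces of a piecewise smooth function are its restrictions to the edges. -/
lemma IsPiecewiseSmooth.isTrace (h : T.IsPiecewiseSmooth w φ) {e : Finset Plane} (he : e.card = 2)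
    {g : Plane → ℝ} (hg : Set.EqOn w g (hull e)) : T.IsTrace w (gradient w) e g := by
  intro t ht het
  have hmem : ∀ᵐ x ∂(arc e), x ∈ hull e := ae_restrict_mem (measurableSet_hull e)
  have hφg : φ t =ᵐ[arc e] g := by
    filter_upwards [hmem] with x hx
    rw [← hg hx, (h t ht).2 (hull_mono het hx)]
  have hφc := (h t ht).1.continuous
  have hin : ∀ᵐ x ∂(volume.restrict (interior (hull t))), x ∈ interior (hull t) :=
    ae_restrict_mem isOpen_interior.measurableSet
  refine ⟨?_, fun _ => φ t, fun _ => (h t ht).1, ?_, ?_, ?_⟩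
  · rw [← memLp_congr_ae hφg]
    exact memLp_arc he hφc.continuousOn
  · apply tendsto_const_nhds.congr
    intro _
    symm
    rw [eLpNorm_congr_ae (g := 0), eLpNorm_zero]
    filter_upwards [hin] with x hx
    rw [(h t ht).2 (interior_subset hx)]
    simp
  · apply tendsto_const_nhds.congr
    intro _
    symm
    rw [eLpNorm_congr_ae (g := 0), eLpNorm_zero]
    filter_upwards [hin] with x hx
    rw [h.gradient_eq ht hx]
    simp
  · apply tendsto_const_nhds.congr
    intro _
    symm
    rw [eLpNorm_congr_ae (g := 0), eLpNorm_zero]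
    filter_upwards [hφg] with x hx
    rw [hx]
    simp

end RegularTriangulation

/-! ### The upper bound -/

lemma exists_antiderivative (g : Polynomial ℝ) :
    ∃ Q : Polynomial ℝ, Q.derivative = g ∧ Q.eval 0 = 0 := by
  induction g using Polynomial.induction_on' with
  | add p q hp hq =>
    obtain ⟨P, hP, hP0⟩ := hp
    obtain ⟨Q, hQ, hQ0⟩ := hq
    exact ⟨P + Q, by simp [hP, hQ], by simp [hP0, hQ0]⟩
  | monomial n c =>
    refine ⟨Polynomial.monomial (n + 1) (c / (n + 1)), ?_, by simp⟩
    rw [Polynomial.derivative_monomial]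
    congr 1
    push_cast
    have : (n : ℝ) + 1 ≠ 0 := by positivity
    rw [div_mul_cancel₀ _ this]

lemma eLpNorm_two_eq {α E : Type*} [MeasurableSpace α] {μ : Measure α} [NormedAddCommGroup E]
    {f : α → E} (hf : MemLp f 2 μ) :
    eLpNorm f 2 μ = ENNReal.ofReal (Real.sqrt (∫ x, ‖f x‖ ^ 2 ∂μ)) := by
  rw [hf.eLpNorm_eq_integral_rpow_norm (by simp) (by simp), Real.sqrt_eq_rpow]
  simp

/-- The data of an edgewise polynomial on one edge: `a` and `b` are the endpoints of `e`, and `g` is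
the polynomial `q` in the affine parameter that runs from `0` at `a` to `1` at `b`. -/
structure IsEdgePolynomial (k : ℕ) (e : Finset Plane) (q : Plane → ℝ) (a b : Plane)
    (g : Polynomial ℝ) : Prop where
  ne : a ≠ b
  coe_eq : (e : Set Plane) = {a, b}
  natDegree_le : g.natDegree ≤ k
  eq_eval : ∀ s ∈ Set.Icc (0 : ℝ) 1, q (AffineMap.lineMap a b s) = g.eval s
  continuousOn : ContinuousOn q (hull e)

lemma exists_isEdgePolynomial {k : ℕ} {e : Finset Plane} (he : e.card = 2) {q : Plane → ℝ}
    {p : MvPolynomial (Fin 2) ℝ} (hp : p.totalDegree ≤ k)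
    (hq : ∀ x ∈ hull e, q x = MvPolynomial.eval (fun i => x i) p) :
    ∃ a b g, IsEdgePolynomial k e q a b g := by
  classical
  obtain ⟨a, b, hab, rfl⟩ := Finset.card_eq_two.1 he
  have hcoe : (({a, b} : Finset Plane) : Set Plane) = {a, b} := by simp
  refine ⟨a, b, MvPolynomial.aeval (fun i => Polynomial.C (a i) +
    Polynomial.C (b i - a i) * Polynomial.X) p, hab, hcoe, ?_, ?_, ?_⟩
  · have := MvPolynomial.aeval_natDegree_le p hp (fun i => Polynomial.C (a i) +
      Polynomial.C (b i - a i) * Polynomial.X) (n := 1) (fun i => by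
        rw [add_comm]
        exact Polynomial.natDegree_linear_le)
    simpa using this
  · intro s hs
    rw [hq _ (lineMap_mem_hull hcoe hs), ← Polynomial.coe_evalRingHom, MvPolynomial.aeval_def,
      MvPolynomial.hom_eval₂]
    have h1 : (Polynomial.evalRingHom s).comp (algebraMap ℝ (Polynomial ℝ)) = RingHom.id ℝ := by
      ext x
      simp
    rw [h1, MvPolynomial.eval₂_id]
    congr 2
    funext i
    simp [AffineMap.lineMap_apply]
    ring
  · have : ContinuousOn (fun x : Plane => MvPolynomial.eval (fun i => x i) p) (hull {a, b}) := by
      apply Continuous.continuousOn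
      exact (MvPolynomial.continuous_eval p).comp (by fun_prop)
    exact this.congr hq

namespace IsEdgePolynomial

variable {k : ℕ} {e : Finset Plane} {q : Plane → ℝ} {a b : Plane} {g : Polynomial ℝ}

lemma card_eq (h : IsEdgePolynomial k e q a b g) : e.card = 2 := by
  classical
  have : e = {a, b} := by
    apply Finset.coe_injective
    simpa using h.coe_eq
  rw [this, Finset.card_pair h.ne]

lemma integral_mul (h : IsEdgePolynomial k e q a b g) (f : Plane → ℝ) :
    ∫ x, q x * f x ∂(arc e) =
      dist a b * ∫ s in (0 : ℝ)..1, g.eval s * f (AffineMap.lineMap a b s) := by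
  rw [integral_arc h.coe_eq h.ne]
  congr 1
  apply intervalIntegral.integral_congr
  intro s hs
  rw [Set.uIcc_of_le zero_le_one] at hs
  simp only [h.eq_eval s hs]

lemma integral_sq (h : IsEdgePolynomial k e q a b g) :
    ∫ x, q x ^ 2 ∂(arc e) = dist a b * ∫ s in (0 : ℝ)..1, g.eval s ^ 2 := by
  rw [integral_arc h.coe_eq h.ne]
  congr 1
  apply intervalIntegral.integral_congr
  intro s hs
  rw [Set.uIcc_of_le zero_le_one] at hs
  simp only [h.eq_eval s hs]

end IsEdgePolynomial

/-- The trace estimate on a shape regular triangle, for smooth functions. -/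
lemma sq_integral_arc_le {k : ℕ} {Ck : ℝ}
    (hCk : ∀ g : Polynomial ℝ, g.natDegree ≤ k → ∀ s ∈ Set.Icc (0 : ℝ) 1,
      g.eval s ^ 2 ≤ Ck * bubbleSq g) (hCk0 : 0 ≤ Ck) {σ : ℝ} (hσ : 0 < σ) (hσ1 : σ ≤ 1)
    {t e : Finset Plane} (hs : ShapeRegular σ t) {a b c : Plane} {q : Plane → ℝ}
    {g : Polynomial ℝ} (hq : IsEdgePolynomial k e q a b g)
    (ht : (t : Set Plane) = {a, b, c}) (hca : c ≠ a) (hcb : c ≠ b)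
    (hq0 : ∫ x, q x ∂(arc e) = 0) {φ : Plane → ℝ} (hφ : ContDiff ℝ ∞ φ) :
    (∫ x, q x * φ x ∂(arc e)) ^ 2 ≤ 4 * Ck / σ ^ 4 * (edgeLength e * ∫ x, q x ^ 2 ∂(arc e)) *
      ∫ x in hull t, ‖gradient φ x‖ ^ 2 := by
  have ha : a ∈ t := by rw [← Finset.mem_coe, ht]; simp
  have hb : b ∈ t := by rw [← Finset.mem_coe, ht]; simp
  have hc : c ∈ t := by rw [← Finset.mem_coe, ht]; simp
  have hab := hq.ne
  set h := dist a b with hh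
  have hh0 : 0 < h := dist_pos.2 hab
  obtain ⟨Q, rfl, hQ0⟩ := exists_antiderivative g
  set g := Q.derivative with hg
  have hQ1 : Q.eval 1 = 0 := by
    have h1 := hq.integral_mul (fun _ => 1)
    simp only [mul_one] at h1
    rw [hq0, intervalIntegral.integral_eq_sub_of_hasDerivAt
      (fun s _ => Q.hasDerivAt s) (Continuous.intervalIntegrable (by fun_prop) _ _), hQ0,
      sub_zero] at h1
    exact (mul_eq_zero.1 h1.symm).resolve_left hh0.ne'
  set M := Real.sqrt (Ck * bubbleSq g) with hM
  have hM0 : 0 ≤ M := Real.sqrt_nonneg _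
  have hgM : ∀ s ∈ Set.Icc (0 : ℝ) 1, |g.eval s| ≤ M := fun s hs' =>
    Real.abs_le_sqrt (hCk g hq.natDegree_le s hs')
  have hQM : ∀ s ∈ Set.Icc (0 : ℝ) 1, |Q.eval s| ≤ M := by
    intro s hs'
    have := norm_image_sub_le_of_norm_deriv_le_segment' (f := fun s => Q.eval s)
      (f' := fun s => g.eval s) (a := 0) (b := 1) (C := M)
      (fun x _ => (Q.hasDerivAt x).hasDerivWithinAt)
      (fun x hx => hgM x (Set.Ico_subset_Icc_self hx)) s hs'
    rw [hQ0, sub_zero, sub_zero, Real.norm_eq_abs] at this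
    exact this.trans (mul_le_of_le_one_right hM0 hs'.2)
  have hJ := hs.sq_mul_sq_dist_le hσ ha hb hc hab hcb.symm hca.symm
  rw [← hh] at hJ
  have hJ0 : 0 < |cross (b - a) (c - a)| := lt_of_lt_of_le (by positivity) hJ
  have hd1 : ‖b - a‖ ≤ h / σ := by
    rw [← dist_eq_norm, dist_comm, ← hh, le_div_iff₀ hσ]
    nlinarith
  have hd2 : ‖c - a‖ ≤ h / σ := by
    rw [← dist_eq_norm, le_div_iff₀ hσ, mul_comm]
    exact hs.mul_dist_le ha hb hc hab hcb.symm hca.symm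
  have hd3 : ‖c - b‖ ≤ h / σ := by
    rw [← dist_eq_norm, le_div_iff₀ hσ, mul_comm, hh, dist_comm a b]
    exact hs.mul_dist_le hb ha hc hab.symm hca.symm hcb.symm
  have key := sq_integral_mul_edge_le (abs_pos.1 hJ0) hd1 hd2 hd3 hφ hQ0 hQ1 hQM hgM
  have hhull : convexHull ℝ ({a, b, c} : Set Plane) = hull t := by rw [hull, ht]
  rw [hhull] at key
  set D := ∫ x in hull t, ‖gradient φ x‖ ^ 2 with hD
  have hD0 : 0 ≤ D := integral_nonneg fun x => sq_nonneg _
  have hconst : (2 * M * (h / σ)) ^ 2 / |cross (b - a) (c - a)| ≤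
      4 * Ck / σ ^ 4 * ∫ s in (0 : ℝ)..1, g.eval s ^ 2 := by
    have hM2 : M ^ 2 ≤ Ck * ∫ s in (0 : ℝ)..1, g.eval s ^ 2 := by
      rw [hM, Real.sq_sqrt (mul_nonneg hCk0 (bubbleSq_nonneg g))]
      exact mul_le_mul_of_nonneg_left (bubbleSq_le_integral_sq g) hCk0
    have hI0 : 0 ≤ Ck * ∫ s in (0 : ℝ)..1, g.eval s ^ 2 := (sq_nonneg M).trans hM2
    generalize (∫ s in (0 : ℝ)..1, g.eval s ^ 2) = I at hM2 hI0 ⊢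
    rw [div_le_iff₀ hJ0]
    calc (2 * M * (h / σ)) ^ 2 = 4 / σ ^ 4 * M ^ 2 * (σ ^ 2 * h ^ 2) := by
          field_simp
          ring
      _ ≤ 4 / σ ^ 4 * (Ck * I) * |cross (b - a) (c - a)| :=
        mul_le_mul (mul_le_mul_of_nonneg_left hM2 (by positivity)) hJ (by positivity)
          (by positivity)
      _ = _ := by ring
  rw [hq.integral_mul, hq.integral_sq, edgeLength_eq hq.coe_eq, ← hh, mul_pow]
  refine (mul_le_mul_of_nonneg_left (key.trans (mul_le_mul_of_nonneg_right hconst hD0))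
    (sq_nonneg h)).trans (le_of_eq ?_)
  ring

/-- A bound by the norm of the gradient extends from smooth functions to traces of functions in
`H¹`. -/
lemma abs_integral_mul_trace_le {U : Set Plane} {w : Plane → ℝ} {G : Plane → Plane}
    (hG : MemLp G 2 (volume.restrict U)) (hU : Bornology.IsBounded U) {e : Finset Plane}
    {γ : Plane → ℝ} (hγ : IsTraceFrom U w G e γ) {q : Plane → ℝ} (hq : ∀ p, MemLp q p (arc e))
    (he : e.card = 2) {A : ℝ} (hA : 0 ≤ A)
    (hφ : ∀ φ : Plane → ℝ, ContDiff ℝ ∞ φ →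
      |∫ x, q x * φ x ∂(arc e)| ≤ A * Real.sqrt (∫ x in U, ‖gradient φ x‖ ^ 2)) :
    |∫ x, q x * γ x ∂(arc e)| ≤ A * Real.sqrt (∫ x in U, ‖G x‖ ^ 2) := by
  obtain ⟨hγ2, φ, hφs, -, hφG, hφγ⟩ := hγ
  have hq2 := hq 2
  have hφ2 : ∀ n, MemLp (φ n) 2 (arc e) := fun n =>
    memLp_arc he (hφs n).continuous.continuousOn
  have hlim : Tendsto (fun n => ∫ x, q x * φ n x ∂(arc e)) atTop (𝓝 (∫ x, q x * γ x ∂(arc e))) := by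
    refine tendsto_integral_of_L1' (fun x => q x * γ x) (F := fun n x => q x * φ n x) ?_ ?_ ?_
    · exact (hq2.integrable_mul hγ2).1
    · exact Eventually.of_forall fun n => hq2.integrable_mul (hφ2 n)
    · have h0 : Tendsto (fun n => eLpNorm q 2 (arc e) * eLpNorm (fun x => φ n x - γ x) 2 (arc e))
          atTop (𝓝 0) := by
        have := ENNReal.Tendsto.const_mul hφγ (Or.inr hq2.eLpNorm_ne_top)
        simpa using this
      apply tendsto_of_tendsto_of_tendsto_of_le_of_le tendsto_const_nhds h0 (fun _ => zero_le)
      intro n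
      have hfun : ((fun x => q x * φ n x) - fun x => q x * γ x) =
          q • (fun x => φ n x - γ x) := by
        funext x
        simp [mul_sub]
      have hm : AEStronglyMeasurable (fun x => φ n x - γ x) (arc e) :=
        (hφ2 n).aestronglyMeasurable.sub hγ2.aestronglyMeasurable
      change eLpNorm ((fun x => q x * φ n x) - fun x => q x * γ x) 1 (arc e) ≤ _
      rw [hfun]
      exact eLpNorm_smul_le_mul_eLpNorm hm hq2.aestronglyMeasurable
  have hgrad : ∀ n, MemLp (gradient (φ n)) 2 (volume.restrict U) := by
    intro n
    have hc := continuous_gradient (hφs n)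
    have hfin : IsFiniteMeasure (volume.restrict U) :=
      ⟨by rw [Measure.restrict_apply_univ]; exact hU.measure_lt_top⟩
    obtain ⟨C, hC⟩ := hU.isCompact_closure.exists_bound_of_continuousOn hc.continuousOn
    apply MemLp.of_bound hc.aestronglyMeasurable C
    have : ∀ᵐ x ∂(volume.restrict U), x ∈ closure U :=
      ae_restrict_of_ae_restrict_of_subset subset_closure
        (ae_restrict_mem isClosed_closure.measurableSet)
    filter_upwards [this] with x hx
    exact hC x hx
  have hbound : ∀ n, ENNReal.ofReal |∫ x, q x * φ n x ∂(arc e)| ≤ ENNReal.ofReal A *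
      (eLpNorm (fun x => gradient (φ n) x - G x) 2 (volume.restrict U) +
        eLpNorm G 2 (volume.restrict U)) := by
    intro n
    have h1 : eLpNorm (gradient (φ n)) 2 (volume.restrict U) ≤
        eLpNorm (fun x => gradient (φ n) x - G x) 2 (volume.restrict U) +
        eLpNorm G 2 (volume.restrict U) := by
      have := eLpNorm_add_le ((hgrad n).sub hG).aestronglyMeasurable hG.aestronglyMeasurable
        (p := 2) (by norm_num)
      rw [sub_add_cancel] at this
      exact this
    refine le_trans ?_ (mul_le_mul_right h1 _)
    rw [eLpNorm_two_eq (hgrad n), ← ENNReal.ofReal_mul hA]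
    exact ENNReal.ofReal_le_ofReal (hφ (φ n) (hφs n))
  have hl1 : Tendsto (fun n => ENNReal.ofReal |∫ x, q x * φ n x ∂(arc e)|) atTop
      (𝓝 (ENNReal.ofReal |∫ x, q x * γ x ∂(arc e)|)) :=
    (ENNReal.continuous_ofReal.tendsto _).comp hlim.abs
  have hl2 : Tendsto (fun n => ENNReal.ofReal A *
      (eLpNorm (fun x => gradient (φ n) x - G x) 2 (volume.restrict U) +
        eLpNorm G 2 (volume.restrict U))) atTop
      (𝓝 (ENNReal.ofReal A * (0 + eLpNorm G 2 (volume.restrict U)))) :=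
    ENNReal.Tendsto.const_mul (hφG.add tendsto_const_nhds) (Or.inr ENNReal.ofReal_ne_top)
  have := le_of_tendsto_of_tendsto' hl1 hl2 hbound
  rw [zero_add, eLpNorm_two_eq hG, ← ENNReal.ofReal_mul hA] at this
  exact (ENNReal.ofReal_le_ofReal_iff (by positivity)).1 this

namespace RegularTriangulation

variable {Ω : Set Plane} (T : RegularTriangulation Ω)

open Classical in
lemma card_edges_of_triangle_le {t : Finset Plane} (ht : t ∈ T.triangles)
    {F : Finset (Finset Plane)} (hF : F ⊆ T.edges) : (F.filter fun e => e ⊆ t).card ≤ 3 := by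
  have hsub : (F.filter fun e => e ⊆ t) ⊆ t.powersetCard 2 := by
    intro e he
    rw [Finset.mem_filter] at he
    obtain ⟨t', -, -, hcard⟩ := T.exists_triangle_of_edge (hF he.1)
    exact Finset.mem_powersetCard.2 ⟨he.2, hcard⟩
  have := Finset.card_le_card hsub
  rw [Finset.card_powersetCard, T.card_eq_three t ht] at this
  simpa [Nat.choose] using this

/-- The upper bound for the numerator: the trace estimates on the triangles, summed up by the
Cauchy-Schwarz inequality. Each triangle is used for at most three edges. -/
lemma abs_sum_integral_le {k : ℕ} {Ck : ℝ}
    (hCk : ∀ g : Polynomial ℝ, g.natDegree ≤ k → ∀ s ∈ Set.Icc (0 : ℝ) 1,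
      g.eval s ^ 2 ≤ Ck * bubbleSq g) (hCk0 : 0 ≤ Ck) {σ : ℝ} (hσ : 0 < σ) (hσ1 : σ ≤ 1)
    (hΩ : IsBoundedLipschitzDomain Ω) (hs : ∀ t ∈ T.triangles, ShapeRegular σ t) {ΓD : Set Plane}
    {q : Finset Plane → Plane → ℝ} {a b : Finset Plane → Plane} {g : Finset Plane → Polynomial ℝ}
    (hq : ∀ e ∈ T.edges, IsEdgePolynomial k e (q e) (a e) (b e) (g e))
    (hq0 : ∀ e ∈ T.freeEdges ΓD, ∫ x, q e x ∂(arc e) = 0)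
    {w : Plane → ℝ} {G : Plane → Plane} {γ : Finset Plane → Plane → ℝ}
    (hG : MemLp G 2 (volume.restrict Ω)) (hγ : ∀ e ∈ T.freeEdges ΓD, T.IsTrace w G e (γ e)) :
    |∑ e ∈ T.freeEdges ΓD, ∫ x, q e x * γ e x ∂(arc e)| ≤
      Real.sqrt (12 * Ck / σ ^ 4) * T.edgeNorm ΓD q * Real.sqrt (∫ x in Ω, ‖G x‖ ^ 2) := by
  classical
  set F := T.freeEdges ΓD with hF
  have hFe : F ⊆ T.edges := T.freeEdges_subset_edges ΓD
  choose! τ hτ using fun e (he : e ∈ F) => T.exists_triangle_of_edge (hFe he)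
  set X : Finset Plane → ℝ := fun e => edgeLength e * ∫ x, q e x ^ 2 ∂(arc e) with hX
  set Y : Finset Plane → ℝ := fun t => ∫ x in interior (hull t), ‖G x‖ ^ 2 with hY
  have hX0 : ∀ e, 0 ≤ X e := fun e =>
    mul_nonneg measureReal_nonneg (integral_nonneg fun x => sq_nonneg _)
  have hY0 : ∀ t, 0 ≤ Y t := fun t => integral_nonneg fun x => sq_nonneg _
  have hedge : ∀ e ∈ F, |∫ x, q e x * γ e x ∂(arc e)| ≤
      Real.sqrt (4 * Ck / σ ^ 4 * X e) * Real.sqrt (Y (τ e)) := by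
    intro e he
    obtain ⟨ht, het, hcard⟩ := hτ e he
    have hqe := hq e (hFe he)
    obtain ⟨c, hc, hca, hcb⟩ := T.exists_third_vertex ht het hqe.ne hqe.coe_eq
    apply abs_integral_mul_trace_le (hG.mono_measure
      (Measure.restrict_mono (T.interior_hull_subset hΩ ht) le_rfl))
      ((isCompact_hull _).isBounded.subset interior_subset) (hγ e he _ ht het)
      (fun p => memLp_arc hcard hqe.continuousOn) hcard (Real.sqrt_nonneg _)
    intro φ hφ
    have := sq_integral_arc_le hCk hCk0 hσ hσ1 (hs _ ht) hqe hc hca hcb (hq0 e he) hφ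
    rw [← setIntegral_congr_set (interior_hull_ae_eq _)] at this
    rw [← Real.sqrt_mul (mul_nonneg (by positivity) (hX0 e))]
    exact Real.abs_le_sqrt this
  have hsumY : ∑ e ∈ F, Y (τ e) ≤ 3 * ∫ x in Ω, ‖G x‖ ^ 2 := by
    have hint : IntegrableOn (fun x => ‖G x‖ ^ 2) Ω := hG.integrable_norm_pow (by norm_num)
    rw [T.setIntegral_eq_sum hΩ hint, Finset.mul_sum]
    calc ∑ e ∈ F, Y (τ e) ≤ ∑ e ∈ F, ∑ t ∈ T.triangles, if e ⊆ t then Y t else 0 := by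
          apply Finset.sum_le_sum
          intro e he
          have h1 := Finset.single_le_sum (f := fun t => if e ⊆ t then Y t else 0)
            (fun t _ => by split_ifs; exacts [hY0 t, le_rfl]) (hτ e he).1
          simpa [(hτ e he).2.1] using h1
      _ = ∑ t ∈ T.triangles, ((F.filter fun e => e ⊆ t).card : ℝ) * Y t := by
          rw [Finset.sum_comm]
          apply Finset.sum_congr rfl
          intro t _
          rw [← Finset.sum_filter, Finset.sum_const, nsmul_eq_mul]
      _ ≤ ∑ t ∈ T.triangles, 3 * Y t := by
          apply Finset.sum_le_sum
          intro t ht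
          apply mul_le_mul_of_nonneg_right _ (hY0 t)
          exact_mod_cast T.card_edges_of_triangle_le ht hFe
  calc |∑ e ∈ F, ∫ x, q e x * γ e x ∂(arc e)|
      ≤ ∑ e ∈ F, |∫ x, q e x * γ e x ∂(arc e)| := Finset.abs_sum_le_sum_abs _ _
    _ ≤ ∑ e ∈ F, Real.sqrt (4 * Ck / σ ^ 4 * X e) * Real.sqrt (Y (τ e)) :=
        Finset.sum_le_sum hedge
    _ ≤ Real.sqrt (∑ e ∈ F, 4 * Ck / σ ^ 4 * X e) * Real.sqrt (∑ e ∈ F, Y (τ e)) :=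
        Real.sum_sqrt_mul_sqrt_le _ (fun e => mul_nonneg (by positivity) (hX0 e))
          (fun e => hY0 _)
    _ ≤ Real.sqrt (∑ e ∈ F, 4 * Ck / σ ^ 4 * X e) * Real.sqrt (3 * ∫ x in Ω, ‖G x‖ ^ 2) := by
        gcongr
    _ = _ := by
        have hXs : 0 ≤ ∑ e ∈ F, X e := Finset.sum_nonneg fun e _ => hX0 e
        have hc : 0 ≤ 12 * Ck / σ ^ 4 := by positivity
        change _ = Real.sqrt (12 * Ck / σ ^ 4) * Real.sqrt (∑ e ∈ F, X e) * _
        rw [← Finset.mul_sum, ← Real.sqrt_mul hc, ← Real.sqrt_mul (mul_nonneg hc hXs),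
          ← Real.sqrt_mul (mul_nonneg (by positivity) hXs)]
        congr 1
        ring

end RegularTriangulation

/-! ### Hat functions -/

namespace RegularTriangulation

variable {Ω : Set Plane} (T : RegularTriangulation Ω)

lemma coord_vertex {t : Finset Plane} (ht : t ∈ T.triangles) {v w : Plane} (hw : w ∈ t) :
    coord t v w = open Classical in if v = w then 1 else 0 := by
  classical
  convert coord_apply (T.card_eq_three t ht) (T.affineIndependent t ht) v hw

/-- The barycentric coordinates of two triangles agree where the triangles meet. -/
lemma coord_eq_coord {s t : Finset Plane} (hs : s ∈ T.triangles) (ht : t ∈ T.triangles) (v : Plane)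
    {x : Plane} (hxs : x ∈ hull s) (hxt : x ∈ hull t) : coord s v x = coord t v x := by
  have hx : x ∈ convexHull ℝ ((s : Set Plane) ∩ (t : Set Plane)) := by
    rw [← T.hull_inter s hs t ht]
    exact ⟨hxs, hxt⟩
  refine AffineMap.eqOn_convexHull ?_ hx
  rintro w ⟨hws, hwt⟩
  rw [T.coord_vertex hs hws, T.coord_vertex ht hwt]

/-- Barycentric coordinates vanish on the side opposite to their vertex. -/
lemma coord_eq_zero {e t : Finset Plane} (ht : t ∈ T.triangles) (het : e ⊆ t) {v : Plane}
    (hv : v ∉ e) {x : Plane} (hx : x ∈ hull e) : coord t v x = 0 := by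
  have : Set.EqOn (coord t v) (0 : Plane →ᵃ[ℝ] ℝ) (e : Set Plane) := by
    intro w hw
    rw [T.coord_vertex ht (het hw), if_neg]
    · rfl
    · exact fun h => hv (h ▸ hw)
  exact AffineMap.eqOn_convexHull this hx

/-- The hat function at the vertex `v`, which is the barycentric coordinate at `v` on each
triangle. It is set to zero outside of the closure of the domain. -/
noncomputable def hat (v : Plane) (x : Plane) : ℝ :=
  open Classical in
  if h : ∃ t ∈ T.triangles, x ∈ hull t then coord h.choose v x else 0

lemma hat_eq_coord {t : Finset Plane} (ht : t ∈ T.triangles) (v : Plane) {x : Plane}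
    (hx : x ∈ hull t) : T.hat v x = coord t v x := by
  have h : ∃ t ∈ T.triangles, x ∈ hull t := ⟨t, ht, hx⟩
  rw [hat, dif_pos h]
  exact T.coord_eq_coord h.choose_spec.1 ht v h.choose_spec.2 hx

lemma hat_eq_zero {e : Finset Plane} (he : e ∈ T.edges) {v : Plane} (hv : v ∉ e) {x : Plane}
    (hx : x ∈ hull e) : T.hat v x = 0 := by
  obtain ⟨t, ht, het, -⟩ := T.exists_triangle_of_edge he
  rw [T.hat_eq_coord ht v (hull_mono het hx), T.coord_eq_zero ht het hv hx]

lemma hat_lineMap {e : Finset Plane} (he : e ∈ T.edges) {a b : Plane}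
    (hab : a ≠ b) (hcoe : (e : Set Plane) = {a, b}) {s : ℝ} (hs : s ∈ Set.Icc (0 : ℝ) 1) :
    T.hat a (AffineMap.lineMap a b s) = 1 - s ∧ T.hat b (AffineMap.lineMap a b s) = s := by
  obtain ⟨t, ht, het, -⟩ := T.exists_triangle_of_edge he
  have ha : a ∈ t := het (by rw [← Finset.mem_coe, hcoe]; simp)
  have hb : b ∈ t := het (by rw [← Finset.mem_coe, hcoe]; simp)
  have hx := hull_mono het (lineMap_mem_hull hcoe hs)
  rw [T.hat_eq_coord ht a hx, T.hat_eq_coord ht b hx, AffineMap.apply_lineMap,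
    AffineMap.apply_lineMap, T.coord_vertex ht ha, T.coord_vertex ht hb, T.coord_vertex ht ha,
    T.coord_vertex ht hb]
  simp [hab, hab.symm, AffineMap.lineMap_apply]
  ring

variable {T}

lemma eqOn_zero_of_ae {w : Plane → ℝ} (hΩ : IsOpen Ω) (hw : ContinuousOn w (closure Ω))
    (h0 : w =ᵐ[volume.restrict Ω] 0) : Set.EqOn w 0 (closure Ω) := by
  have h1 : Set.EqOn w 0 Ω := Measure.eqOn_open_of_ae_eq h0 hΩ (hw.mono subset_closure)
    continuousOn_const
  exact h1.of_subset_closure hw continuousOn_const subset_closure subset_rfl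

/-! ### A function with vanishing traces -/

/-- The set of quotients contains zero, which is the quotient of a cubic bubble function. -/
lemma zero_mem_dualQuotients (hΩ : IsBoundedLipschitzDomain Ω) (ΓD : Set Plane)
    (q : Finset Plane → Plane → ℝ) : (0 : ℝ) ∈ T.dualQuotients ΓD q := by
  classical
  obtain ⟨y, hy⟩ := hΩ.isConnected.nonempty
  obtain ⟨t₀, ht₀, -⟩ := T.exists_mem_hull (subset_closure hy)
  obtain ⟨a, b, c, hab, hac, hbc, habc⟩ := Finset.card_eq_three.1 (T.card_eq_three t₀ ht₀)
  set w : Plane → ℝ := fun x => T.hat a x * T.hat b x * T.hat c x with hw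
  have hps : T.IsPiecewiseSmooth w fun t x => coord t a x * coord t b x * coord t c x := by
    intro t ht
    refine ⟨?_, fun x hx => ?_⟩
    · exact ((coord t a).contDiff_plane.mul (coord t b).contDiff_plane).mul
        (coord t c).contDiff_plane
    · simp only [hw, T.hat_eq_coord ht _ hx]
  have hedge : ∀ e ∈ T.edges, Set.EqOn w (fun _ => 0) (hull e) := by
    intro e he x hx
    obtain ⟨-, -, -, hcard⟩ := T.exists_triangle_of_edge he
    have hne : ¬ t₀ ⊆ e := fun h => by
      have := Finset.card_le_card h
      rw [T.card_eq_three t₀ ht₀, hcard] at this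
      omega
    obtain ⟨v, hv, hve⟩ := Finset.not_subset.1 hne
    have h0 := T.hat_eq_zero he hve hx
    rw [habc] at hv
    simp only [Finset.mem_insert, Finset.mem_singleton] at hv
    rcases hv with rfl | rfl | rfl <;> simp [hw, h0]
  have htrace : ∀ e ∈ T.edges, T.IsTrace w (gradient w) e fun _ => 0 := fun e he => by
    obtain ⟨-, -, -, hcard⟩ := T.exists_triangle_of_edge he
    exact hps.isTrace hcard (hedge e he)
  refine ⟨w, gradient w, fun _ _ => 0, ⟨hps.isH1 hΩ, fun e he =>
    htrace e (T.dirichletEdges_subset_edges ΓD he)⟩, ?_, fun e he =>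
    htrace e (T.freeEdges_subset_edges ΓD he), by simp⟩
  intro h0
  have hzero := eqOn_zero_of_ae hΩ.isOpen hps.continuousOn h0
  have ha : a ∈ t₀ := by rw [habc]; simp
  have hb : b ∈ t₀ := by rw [habc]; simp
  have hc : c ∈ t₀ := by rw [habc]; simp
  -- The bubble function is positive at the barycentre.
  have hx : AffineMap.lineMap (AffineMap.lineMap a b (1 / 2 : ℝ) : Plane) c (1 / 3 : ℝ) ∈
      hull t₀ := by
    have hsub := subset_convexHull ℝ (t₀ : Set Plane)
    apply (convex_hull t₀).lineMap_mem _ (hsub hc) ⟨by norm_num, by norm_num⟩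
    exact (convex_hull t₀).lineMap_mem (hsub ha) (hsub hb) ⟨by norm_num, by norm_num⟩
  have := hzero (T.hull_subset_closure ht₀ hx)
  simp only [hw, T.hat_eq_coord ht₀ _ hx, AffineMap.apply_lineMap, T.coord_vertex ht₀ ha,
    T.coord_vertex ht₀ hb, T.coord_vertex ht₀ hc] at this
  simp [hab, hac, hbc, hab.symm, hac.symm, hbc.symm, AffineMap.lineMap_apply] at this
  norm_num at this

/-! ### The lower bound -/

/-- The combination of edge bubble functions that realizes the lower bound. On the edge `e` it is
`h_e s (1 - s) q`, where `s` is the affine parameter of the edge. -/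
noncomputable def edgeBubble (T : RegularTriangulation Ω) (F : Finset (Finset Plane))
    (a b : Finset Plane → Plane) (g : Finset Plane → Polynomial ℝ) (x : Plane) : ℝ :=
  ∑ e ∈ F, edgeLength e * (T.hat (a e) x * T.hat (b e) x * (g e).eval (T.hat (b e) x))

open Classical in
/-- The smooth function with which the combination of edge bubble functions agrees on the triangle
`t`. Only the edges of `t` contribute. -/
noncomputable def edgeBubbleOn (F : Finset (Finset Plane))
    (a b : Finset Plane → Plane) (g : Finset Plane → Polynomial ℝ) (t : Finset Plane)
    (x : Plane) : ℝ :=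
  ∑ e ∈ F.filter fun e => e ⊆ t,
    edgeLength e * (coord t (a e) x * coord t (b e) x * (g e).eval (coord t (b e) x))

section EdgeBubble

variable {k : ℕ} {q : Finset Plane → Plane → ℝ} {a b : Finset Plane → Plane}
  {g : Finset Plane → Polynomial ℝ} {F : Finset (Finset Plane)}

lemma endpoints_subset_iff (hq : ∀ e ∈ T.edges, IsEdgePolynomial k e (q e) (a e) (b e) (g e))
    {e : Finset Plane} (he : e ∈ T.edges) (u : Finset Plane) : e ⊆ u ↔ a e ∈ u ∧ b e ∈ u := by
  rw [← Finset.coe_subset, (hq e he).coe_eq, Set.insert_subset_iff, Set.singleton_subset_iff]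
  simp

lemma isPiecewiseSmooth_edgeBubble
    (hq : ∀ e ∈ T.edges, IsEdgePolynomial k e (q e) (a e) (b e) (g e)) (hF : F ⊆ T.edges) :
    T.IsPiecewiseSmooth (T.edgeBubble F a b g) (edgeBubbleOn F a b g) := by
  classical
  intro t ht
  constructor
  · apply ContDiff.sum
    intro e _
    have hp : ContDiff ℝ ∞ fun x => (g e).eval x := by
      simpa using (g e).contDiff_aeval (𝕜 := ℝ) ∞
    exact contDiff_const.mul (((coord t (a e)).contDiff_plane.mul
      (coord t (b e)).contDiff_plane).mul (hp.comp (coord t (b e)).contDiff_plane))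
  · intro x hx
    rw [edgeBubble, edgeBubbleOn, Finset.sum_filter]
    apply Finset.sum_congr rfl
    intro e he
    rw [T.hat_eq_coord ht _ hx, T.hat_eq_coord ht _ hx]
    split_ifs with het
    · rfl
    · rw [endpoints_subset_iff hq (hF he)] at het
      by_cases ha : a e ∈ t
      · have hb : b e ∉ t := fun hb => het ⟨ha, hb⟩
        rw [T.coord_eq_zero ht subset_rfl hb hx]
        simp
      · rw [T.coord_eq_zero ht subset_rfl ha hx]
        simp

/-- On an edge, the combination of edge bubble functions reduces to the contribution of this
edge. -/
lemma edgeBubble_on_edge (hq : ∀ e ∈ T.edges, IsEdgePolynomial k e (q e) (a e) (b e) (g e))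
    (hF : F ⊆ T.edges) {e : Finset Plane} (he : e ∈ T.edges) {x : Plane} (hx : x ∈ hull e) :
    T.edgeBubble F a b g x = open Classical in if e ∈ F then
      edgeLength e * (T.hat (a e) x * T.hat (b e) x * (g e).eval (T.hat (b e) x)) else 0 := by
  classical
  have hzero : ∀ e' ∈ F, e' ≠ e →
      edgeLength e' * (T.hat (a e') x * T.hat (b e') x * (g e').eval (T.hat (b e') x)) = 0 := by
    intro e' he' hne
    have hsub : ¬ e' ⊆ e := fun h => hne <| Finset.eq_of_subset_of_card_le h
      (by rw [(hq e he).card_eq, (hq e' (hF he')).card_eq])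
    rw [endpoints_subset_iff hq (hF he')] at hsub
    by_cases ha : a e' ∈ e
    · rw [T.hat_eq_zero he (fun hb => hsub ⟨ha, hb⟩) hx]
      simp
    · rw [T.hat_eq_zero he ha hx]
      simp
  rw [edgeBubble]
  split_ifs with heF
  · exact Finset.sum_eq_single_of_mem e heF hzero
  · exact Finset.sum_eq_zero fun e' he' => hzero e' he' fun h => heF (h ▸ he')

lemma integral_mul_edgeBubble
    (hq : ∀ e ∈ T.edges, IsEdgePolynomial k e (q e) (a e) (b e) (g e))
    (hF : F ⊆ T.edges) {e : Finset Plane} (he : e ∈ F) :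
    ∫ x, q e x * T.edgeBubble F a b g x ∂(arc e) = edgeLength e ^ 2 * bubbleSq (g e) := by
  have hqe := hq e (hF he)
  rw [hqe.integral_mul, ← edgeLength_eq hqe.coe_eq, bubbleSq, sq, mul_assoc,
    ← intervalIntegral.integral_const_mul (edgeLength e) fun s => s * (1 - s) * (g e).eval s ^ 2]
  congr 1
  apply intervalIntegral.integral_congr
  intro s hs
  rw [Set.uIcc_of_le zero_le_one] at hs
  obtain ⟨h1, h2⟩ := T.hat_lineMap (hF he) hqe.ne hqe.coe_eq hs
  simp only [edgeBubble_on_edge hq hF (hF he) (lineMap_mem_hull hqe.coe_eq hs), if_pos he, h1, h2]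
  ring

/-- The gradient of the combination of edge bubble functions on a triangle is bounded by the
weighted norms of the polynomials, because the edge length cancels the inverse height in
the gradients of the barycentric coordinates. -/
lemma sq_norm_gradient_edgeBubbleOn_le {Ck : ℝ}
    (hCk : ∀ g : Polynomial ℝ, g.natDegree ≤ k → ∀ s ∈ Set.Icc (0 : ℝ) 1,
      g.eval s ^ 2 ≤ Ck * bubbleSq g ∧ g.derivative.eval s ^ 2 ≤ Ck * bubbleSq g)
    (hCk0 : 0 ≤ Ck) {σ : ℝ} (hσ : 0 < σ)
    (hq : ∀ e ∈ T.edges, IsEdgePolynomial k e (q e) (a e) (b e) (g e))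
    (hF : F ⊆ T.edges) {t : Finset Plane} (ht : t ∈ T.triangles) (hs : ShapeRegular σ t)
    {x : Plane} (hx : x ∈ hull t) :
    ‖gradient (edgeBubbleOn F a b g t) x‖ ^ 2 ≤
      27 * Ck / σ ^ 2 * open Classical in ∑ e ∈ F.filter fun e => e ⊆ t, bubbleSq (g e) := by
  classical
  set L : Finset Plane → Plane →L[ℝ] ℝ := fun e =>
    edgeLength e • ((coord t (a e) x * coord t (b e) x) •
        ((g e).derivative.eval (coord t (b e) x) • (coord t (b e)).slope) +
      (g e).eval (coord t (b e) x) • (coord t (a e) x • (coord t (b e)).slope +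
        coord t (b e) x • (coord t (a e)).slope)) with hL
  have hder : HasFDerivAt (edgeBubbleOn F a b g t) (∑ e ∈ F.filter fun e => e ⊆ t, L e) x := by
    apply HasFDerivAt.fun_sum
    intro e _
    have h1 := (coord t (a e)).hasFDerivAt_slope x
    have h2 := (coord t (b e)).hasFDerivAt_slope x
    have h3 := ((g e).hasDerivAt (coord t (b e) x)).comp_hasFDerivAt x h2
    exact ((h1.mul h2).mul h3).const_mul (edgeLength e)
  have hLe : ∀ e ∈ F.filter fun e => e ⊆ t, ‖L e‖ ≤ 3 / σ * Real.sqrt (Ck * bubbleSq (g e)) := by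
    intro e he
    obtain ⟨heF, het⟩ := Finset.mem_filter.1 he
    have hqe := hq e (hF heF)
    obtain ⟨ha, hb⟩ := (endpoints_subset_iff hq (hF heF) t).1 het
    have hd : 0 < dist (a e) (b e) := dist_pos.2 hqe.ne
    have n1 := norm_slope_coord_le hσ (T.card_eq_three t ht) (T.affineIndependent t ht) hs ha hb
      hqe.ne
    have n2 := norm_slope_coord_le hσ (T.card_eq_three t ht) (T.affineIndependent t ht) hs hb ha
      hqe.ne.symm
    rw [dist_comm] at n2
    have c1 := coord_mem_Icc (T.card_eq_three t ht) (T.affineIndependent t ht) (a e) hx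
    have c2 := coord_mem_Icc (T.card_eq_three t ht) (T.affineIndependent t ht) (b e) hx
    obtain ⟨g1, g2⟩ := hCk (g e) hqe.natDegree_le _ c2
    replace g1 := Real.abs_le_sqrt g1
    replace g2 := Real.abs_le_sqrt g2
    set M := Real.sqrt (Ck * bubbleSq (g e)) with hM
    have hM0 : 0 ≤ M := Real.sqrt_nonneg _
    set r := (σ * dist (a e) (b e))⁻¹ with hr
    have hr0 : 0 ≤ r := by positivity
    simp only [hL]
    rw [norm_smul, edgeLength_eq hqe.coe_eq, Real.norm_of_nonneg hd.le]
    set α := coord t (a e) x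
    set β := coord t (b e) x
    have hα : ‖α‖ ≤ 1 := by rw [Real.norm_of_nonneg c1.1]; exact c1.2
    have hβ : ‖β‖ ≤ 1 := by rw [Real.norm_of_nonneg c2.1]; exact c2.2
    have b1 : ‖(α * β) • ((g e).derivative.eval β • (coord t (b e)).slope)‖ ≤ M * r := by
      rw [norm_smul, norm_smul, norm_mul]
      have h1 : ‖α‖ * ‖β‖ ≤ 1 := mul_le_one₀ hα (norm_nonneg _) hβ
      have h2 : ‖(g e).derivative.eval β‖ * ‖(coord t (b e)).slope‖ ≤ M * r :=
        mul_le_mul g2 n2 (norm_nonneg _) hM0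
      exact (mul_le_of_le_one_left (by positivity) h1).trans h2
    have b2 : ‖(g e).eval β • (α • (coord t (b e)).slope + β • (coord t (a e)).slope)‖ ≤
        M * (r + r) := by
      rw [norm_smul]
      apply mul_le_mul g1 _ (norm_nonneg _) hM0
      refine (norm_add_le _ _).trans ?_
      rw [norm_smul, norm_smul]
      exact add_le_add ((mul_le_of_le_one_left (norm_nonneg _) hα).trans n2)
        ((mul_le_of_le_one_left (norm_nonneg _) hβ).trans n1)
    calc dist (a e) (b e) * _ ≤ dist (a e) (b e) * (M * r + M * (r + r)) :=
          mul_le_mul_of_nonneg_left ((norm_add_le _ _).trans (add_le_add b1 b2)) hd.le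
      _ = 3 / σ * M := by
        rw [hr]
        field_simp
        ring
  rw [norm_gradient, hder.fderiv]
  have hcard : ((F.filter fun e => e ⊆ t).card : ℝ) ≤ 3 := by
    exact_mod_cast T.card_edges_of_triangle_le ht hF
  calc ‖∑ e ∈ F.filter fun e => e ⊆ t, L e‖ ^ 2
      ≤ (∑ e ∈ F.filter fun e => e ⊆ t, ‖L e‖) ^ 2 :=
        pow_le_pow_left₀ (norm_nonneg _) (norm_sum_le _ _) 2
    _ ≤ (F.filter fun e => e ⊆ t).card * ∑ e ∈ F.filter fun e => e ⊆ t, ‖L e‖ ^ 2 :=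
        sq_sum_le_card_mul_sum_sq
    _ ≤ 3 * ∑ e ∈ F.filter fun e => e ⊆ t, ‖L e‖ ^ 2 :=
        mul_le_mul_of_nonneg_right hcard (Finset.sum_nonneg fun e _ => sq_nonneg _)
    _ ≤ 3 * ∑ e ∈ F.filter fun e => e ⊆ t, 9 * Ck / σ ^ 2 * bubbleSq (g e) := by
        apply mul_le_mul_of_nonneg_left _ (by norm_num)
        apply Finset.sum_le_sum
        intro e he
        refine (pow_le_pow_left₀ (norm_nonneg _) (hLe e he) 2).trans (le_of_eq ?_)
        rw [mul_pow, Real.sq_sqrt (mul_nonneg hCk0 (bubbleSq_nonneg _))]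
        ring
    _ = _ := by
        rw [← Finset.mul_sum]
        ring

lemma volume_hull_le {σ : ℝ} (hσ : 0 < σ) (hσ1 : σ ≤ 1) {t e : Finset Plane}
    (ht : t ∈ T.triangles) (het : e ⊆ t) (hs : ShapeRegular σ t) {a b : Plane} (hab : a ≠ b)
    (hcoe : (e : Set Plane) = {a, b}) :
    (volume : Measure Plane).real (hull t) ≤
      (edgeLength e / σ) ^ 2 * (volume : Measure Plane).real (Metric.ball 0 1) := by
  obtain ⟨c, htc, hca, hcb⟩ := T.exists_third_vertex ht het hab hcoe
  have ha : a ∈ t := by rw [← Finset.mem_coe, htc]; simp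
  have hb : b ∈ t := by rw [← Finset.mem_coe, htc]; simp
  have hc : c ∈ t := by rw [← Finset.mem_coe, htc]; simp
  rw [edgeLength_eq hcoe]
  have hd : 0 < dist a b := dist_pos.2 hab
  have hsub : hull t ⊆ Metric.closedBall a (dist a b / σ) := by
    apply convexHull_min _ (convex_closedBall _ _)
    rw [htc]
    rintro y (rfl | rfl | rfl)
    · simp
      positivity
    · rw [Metric.mem_closedBall, dist_comm, le_div_iff₀ hσ]
      nlinarith
    · rw [Metric.mem_closedBall, le_div_iff₀ hσ, mul_comm]
      exact hs.mul_dist_le ha hb hc hab hcb.symm hca.symm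
  refine (measureReal_mono hsub measure_closedBall_lt_top.ne).trans (le_of_eq ?_)
  rw [Measure.real, Measure.addHaar_closedBall _ _ (by positivity), ENNReal.toReal_mul,
    ENNReal.toReal_ofReal (by positivity), finrank_euclideanSpace_fin, Measure.real]

/-- The energy of the combination of edge bubble functions. Each edge contributes on at most two
triangles. -/
lemma integral_sq_gradient_edgeBubble_le {Ck : ℝ}
    (hCk : ∀ g : Polynomial ℝ, g.natDegree ≤ k → ∀ s ∈ Set.Icc (0 : ℝ) 1,
      g.eval s ^ 2 ≤ Ck * bubbleSq g ∧ g.derivative.eval s ^ 2 ≤ Ck * bubbleSq g)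
    (hCk0 : 0 ≤ Ck) {σ : ℝ} (hσ : 0 < σ) (hσ1 : σ ≤ 1) (hΩ : IsBoundedLipschitzDomain Ω)
    (hs : ∀ t ∈ T.triangles, ShapeRegular σ t)
    (hq : ∀ e ∈ T.edges, IsEdgePolynomial k e (q e) (a e) (b e) (g e)) (hF : F ⊆ T.edges) :
    ∫ x in Ω, ‖gradient (T.edgeBubble F a b g) x‖ ^ 2 ≤
      54 * Ck / σ ^ 4 * (volume : Measure Plane).real (Metric.ball 0 1) *
        ∑ e ∈ F, edgeLength e ^ 2 * bubbleSq (g e) := by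
  classical
  set V := (volume : Measure Plane).real (Metric.ball 0 1) with hV
  have hV0 : 0 ≤ V := measureReal_nonneg
  have hps := isPiecewiseSmooth_edgeBubble hq hF
  have hint : IntegrableOn (fun x => ‖gradient (T.edgeBubble F a b g) x‖ ^ 2) Ω :=
    (hps.isH1 hΩ).memLp_grad.integrable_norm_pow (by norm_num)
  rw [T.setIntegral_eq_sum hΩ hint]
  have htri : ∀ t ∈ T.triangles,
      ∫ x in interior (hull t), ‖gradient (T.edgeBubble F a b g) x‖ ^ 2 ≤
        ∑ e ∈ F.filter fun e => e ⊆ t,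
          27 * Ck / σ ^ 4 * V * (edgeLength e ^ 2 * bubbleSq (g e)) := by
    intro t ht
    have hfin : volume (interior (hull t)) ≠ ⊤ :=
      ((measure_mono interior_subset).trans_lt (isCompact_hull t).measure_lt_top).ne
    set B := 27 * Ck / σ ^ 2 * ∑ e ∈ F.filter fun e => e ⊆ t, bubbleSq (g e) with hB
    have hle : ∫ x in interior (hull t), ‖gradient (T.edgeBubble F a b g) x‖ ^ 2 ≤
        ∫ _x in interior (hull t), B := by
      apply setIntegral_mono_on (hint.mono_set (T.interior_hull_subset hΩ ht))
        (integrableOn_const hfin) isOpen_interior.measurableSet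
      intro x hx
      rw [hps.gradient_eq ht hx]
      exact sq_norm_gradient_edgeBubbleOn_le hCk hCk0 hσ hq hF ht (hs t ht) (interior_subset hx)
    refine hle.trans ?_
    rw [setIntegral_const, smul_eq_mul, measureReal_congr (interior_hull_ae_eq t), hB,
      Finset.mul_sum, Finset.mul_sum]
    apply Finset.sum_le_sum
    intro e he
    obtain ⟨heF, het⟩ := Finset.mem_filter.1 he
    have hqe := hq e (hF heF)
    have hvol := volume_hull_le hσ hσ1 ht het (hs t ht) hqe.ne hqe.coe_eq
    have hb0 : 0 ≤ 27 * Ck / σ ^ 2 * bubbleSq (g e) :=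
      mul_nonneg (by positivity) (bubbleSq_nonneg _)
    refine (mul_le_mul_of_nonneg_right hvol hb0).trans (le_of_eq ?_)
    rw [← hV]
    field_simp
  refine (Finset.sum_le_sum htri).trans ?_
  have hterm : ∀ e, 0 ≤ 27 * Ck / σ ^ 4 * V * (edgeLength e ^ 2 * bubbleSq (g e)) := fun e =>
    mul_nonneg (by positivity) (mul_nonneg (sq_nonneg _) (bubbleSq_nonneg _))
  calc ∑ t ∈ T.triangles, ∑ e ∈ F.filter fun e => e ⊆ t,
        27 * Ck / σ ^ 4 * V * (edgeLength e ^ 2 * bubbleSq (g e))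
      = ∑ e ∈ F, ((T.triangles.filter fun t => e ⊆ t).card : ℝ) *
          (27 * Ck / σ ^ 4 * V * (edgeLength e ^ 2 * bubbleSq (g e))) := by
        simp only [Finset.sum_filter]
        rw [Finset.sum_comm]
        apply Finset.sum_congr rfl
        intro e _
        rw [← Finset.sum_filter, Finset.sum_const, nsmul_eq_mul]
    _ ≤ ∑ e ∈ F, 2 * (27 * Ck / σ ^ 4 * V * (edgeLength e ^ 2 * bubbleSq (g e))) := by
        apply Finset.sum_le_sum
        intro e he
        apply mul_le_mul_of_nonneg_right _ (hterm e)
        exact_mod_cast T.card_filter_edge_subset_le (hq e (hF he)).card_eq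
    _ = _ := by
        rw [Finset.mul_sum]
        apply Finset.sum_congr rfl
        intro e _
        ring

end EdgeBubble

end RegularTriangulation

namespace RegularTriangulation

variable {Ω : Set Plane} {T : RegularTriangulation Ω}

/-! ### Comparison with the dual norm -/

/-- The weighted norm is bounded by the quotient of the combination of edge bubble functions. -/
lemma exists_quotient_ge {k : ℕ} {Ck : ℝ}
    (hCk : ∀ g : Polynomial ℝ, g.natDegree ≤ k → ∀ s ∈ Set.Icc (0 : ℝ) 1,
      g.eval s ^ 2 ≤ Ck * bubbleSq g ∧ g.derivative.eval s ^ 2 ≤ Ck * bubbleSq g)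
    (hCk0 : 0 ≤ Ck) {σ : ℝ} (hσ : 0 < σ) (hσ1 : σ ≤ 1) (hΩ : IsBoundedLipschitzDomain Ω)
    (hs : ∀ t ∈ T.triangles, ShapeRegular σ t) {ΓD : Set Plane} (hΓ : T.ResolvesBoundary ΓD)
    {q : Finset Plane → Plane → ℝ} {a b : Finset Plane → Plane} {g : Finset Plane → Polynomial ℝ}
    (hq : ∀ e ∈ T.edges, IsEdgePolynomial k e (q e) (a e) (b e) (g e))
    (hq0 : ∀ e ∈ T.freeEdges ΓD, ∫ x, q e x ∂(arc e) = 0) :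
    ∃ r ∈ T.dualQuotients ΓD q, T.edgeNorm ΓD q ≤
      Real.sqrt (Ck * (54 * Ck / σ ^ 4 * (volume : Measure Plane).real (Metric.ball 0 1))) * r := by
  set F := T.freeEdges ΓD with hF
  have hFe : F ⊆ T.edges := T.freeEdges_subset_edges ΓD
  set B := 54 * Ck / σ ^ 4 * (volume : Measure Plane).real (Metric.ball 0 1) with hB
  have hB0 : 0 ≤ B := mul_nonneg (by positivity) measureReal_nonneg
  set A := ∑ e ∈ F, edgeLength e ^ 2 * bubbleSq (g e) with hA
  have hA0 : 0 ≤ A :=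
    Finset.sum_nonneg fun e _ => mul_nonneg (sq_nonneg _) (bubbleSq_nonneg _)
  have hnorm : T.edgeNorm ΓD q ≤ Real.sqrt (Ck * A) := by
    apply Real.sqrt_le_sqrt
    rw [hA, Finset.mul_sum]
    apply Finset.sum_le_sum
    intro e he
    have hqe := hq e (hFe he)
    rw [hqe.integral_sq, ← edgeLength_eq hqe.coe_eq]
    have h1 : ∫ s in (0 : ℝ)..1, (g e).eval s ^ 2 ≤ Ck * bubbleSq (g e) := by
      have := intervalIntegral.integral_mono_on (μ := volume) zero_le_one
        (Continuous.intervalIntegrable (by fun_prop : Continuous fun s => (g e).eval s ^ 2) 0 1)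
        (intervalIntegrable_const (c := Ck * bubbleSq (g e)))
        (fun s hs' => (hCk (g e) hqe.natDegree_le s hs').1)
      simpa using this
    nlinarith [mul_le_mul_of_nonneg_left h1 (sq_nonneg (edgeLength e))]
  rcases hA0.eq_or_lt with hA00 | hApos
  · refine ⟨0, zero_mem_dualQuotients hΩ ΓD q, ?_⟩
    rw [← hA00, mul_zero, Real.sqrt_zero] at hnorm
    simpa using hnorm
  set w := T.edgeBubble F a b g with hw
  have hps := isPiecewiseSmooth_edgeBubble hq hFe
  have hH1 : IsH1 Ω w (gradient w) := hps.isH1 hΩ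
  have hnum : ∑ e ∈ F, ∫ x, q e x * w x ∂(arc e) = A :=
    Finset.sum_congr rfl fun e he => integral_mul_edgeBubble hq hFe he
  have htrace : ∀ e ∈ F, T.IsTrace w (gradient w) e w := fun e he =>
    hps.isTrace (hq e (hFe he)).card_eq fun x _ => rfl
  have hdir : ∀ e ∈ T.dirichletEdges ΓD, T.IsTrace w (gradient w) e fun _ => 0 := by
    intro e he
    have hee := T.dirichletEdges_subset_edges ΓD he
    refine hps.isTrace (hq e hee).card_eq fun x hx => ?_
    change w x = 0
    rw [hw, edgeBubble_on_edge hq hFe hee hx,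
      if_neg (T.notMem_freeEdges_of_mem_dirichletEdges hΓ he)]
  set D := Real.sqrt (∫ x in Ω, ‖gradient w x‖ ^ 2) with hD
  have hDle : D ≤ Real.sqrt (B * A) :=
    Real.sqrt_le_sqrt (integral_sq_gradient_edgeBubble_le hCk hCk0 hσ hσ1 hΩ hs hq hFe)
  -- The numerator is positive, so the upper bound shows that the gradient does not vanish.
  have hDpos : 0 < D := by
    rcases (Real.sqrt_nonneg (∫ x in Ω, ‖gradient w x‖ ^ 2)).eq_or_lt with h0 | h0
    · have := T.abs_sum_integral_le (fun g hg s hs' => (hCk g hg s hs').1) hCk0 hσ hσ1 hΩ hs hq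
        hq0 hH1.memLp_grad (γ := fun _ => w) htrace
      rw [hnum, ← h0, mul_zero, abs_of_pos hApos] at this
      exact absurd this (not_le.2 hApos)
    · exact h0
  have hne : ¬ w =ᵐ[volume.restrict Ω] 0 := by
    intro h0
    have hzero := eqOn_zero_of_ae hΩ.isOpen hps.continuousOn h0
    apply hApos.ne
    rw [← hnum]
    symm
    apply Finset.sum_eq_zero
    intro e he
    obtain ⟨t, ht, het, -⟩ := T.exists_triangle_of_edge (hFe he)
    rw [(hq e (hFe he)).integral_mul]
    apply mul_eq_zero_of_right
    rw [intervalIntegral.integral_congr (g := fun _ => 0)]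
    · simp
    · intro s hs'
      rw [Set.uIcc_of_le zero_le_one] at hs'
      have := hzero (T.hull_subset_closure ht
        (hull_mono het (lineMap_mem_hull (hq e (hFe he)).coe_eq hs')))
      change w _ = 0 at this
      simp only [this, mul_zero]
  refine ⟨A / D, ⟨w, gradient w, fun _ => w, ⟨hH1, hdir⟩, hne, htrace, ?_⟩, ?_⟩
  · rw [← Finset.sum_div, hnum]
  · refine hnorm.trans ?_
    rw [← mul_div_assoc, le_div_iff₀ hDpos]
    calc Real.sqrt (Ck * A) * D ≤ Real.sqrt (Ck * A) * Real.sqrt (B * A) := by gcongr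
      _ = Real.sqrt (Ck * B) * A := by
        rw [Real.sqrt_mul hCk0, Real.sqrt_mul hB0, Real.sqrt_mul hCk0]
        linear_combination Real.sqrt Ck * Real.sqrt B * Real.mul_self_sqrt hA0

end RegularTriangulation

theorem lemma4p1 (k : ℕ) (θ : ℝ) (hθ : 0 < θ) :
    ∃ C : ℝ, 0 < C ∧
      ∀ (Ω ΓD : Set Plane) (T : RegularTriangulation Ω) (q : Finset Plane → Plane → ℝ),
        IsBoundedLipschitzDomain Ω →
        IsClosed ΓD → ΓD ⊆ frontier Ω →
        0 < (Measure.hausdorffMeasure 1 : Measure Plane) ΓD →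
        T.ResolvesBoundary ΓD →
        T.AnglesAtLeast θ →
        T.IsEdgewisePolynomial k q →
        (∀ e ∈ T.freeEdges ΓD, ∫ x, q e x ∂(arc e) = 0) →
        ∃ S : ℝ, IsLUB (T.dualQuotients ΓD q) S ∧
          S ≤ C * T.edgeNorm ΓD q ∧ T.edgeNorm ΓD q ≤ C * S := by
  have hθ' : 0 < min θ 1 := lt_min hθ one_pos
  set σ := Real.sin (min θ 1) with hσdef
  have hσ : 0 < σ := by
    apply Real.sin_pos_of_pos_of_lt_pi hθ'
    have := Real.pi_gt_three
    have := min_le_right θ 1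
    linarith
  have hσ1 : σ ≤ 1 := Real.sin_le_one _
  obtain ⟨Ck, hCk1, hCk⟩ := exists_sq_eval_le_bubbleSq k
  have hCk0 : 0 ≤ Ck := zero_le_one.trans hCk1
  set C₁ := Real.sqrt (12 * Ck / σ ^ 4) with hC₁
  set C₂ := Real.sqrt (Ck * (54 * Ck / σ ^ 4 * (volume : Measure Plane).real (Metric.ball 0 1)))
    with hC₂
  have hC₁0 : 0 ≤ C₁ := Real.sqrt_nonneg _
  have hC₂0 : 0 ≤ C₂ := Real.sqrt_nonneg _
  refine ⟨C₁ + C₂ + 1, by positivity, ?_⟩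
  intro Ω ΓD T q hΩ _ _ _ hΓ hangle hpoly hq0
  have hs : ∀ t ∈ T.triangles, ShapeRegular σ t := fun t ht =>
    shapeRegular_of_angle hθ' fun a ha b hb c hc hab hbc hac =>
      (min_le_left θ 1).trans (hangle t ht a ha b hb c hc hab hbc hac)
  have hdata : ∀ e ∈ T.edges, ∃ a b g, IsEdgePolynomial k e (q e) a b g := by
    intro e he
    obtain ⟨-, -, -, hcard⟩ := T.exists_triangle_of_edge he
    obtain ⟨p, hp, hpq⟩ := hpoly e he
    exact exists_isEdgePolynomial hcard hp hpq
  choose! a b g hq using hdata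
  have hN0 : 0 ≤ T.edgeNorm ΓD q := Real.sqrt_nonneg _
  have hub : ∀ r ∈ T.dualQuotients ΓD q, r ≤ C₁ * T.edgeNorm ΓD q := by
    rintro _ ⟨w, G, γ, hw, -, hγ, rfl⟩
    rw [← Finset.sum_div]
    apply div_le_of_le_mul₀ (Real.sqrt_nonneg _) (by positivity)
    exact (le_abs_self _).trans (T.abs_sum_integral_le (fun g hg s hs' => (hCk g hg s hs').1) hCk0
      hσ hσ1 hΩ hs hq hq0 hw.1.memLp_grad hγ)
  have h0 := RegularTriangulation.zero_mem_dualQuotients (T := T) hΩ ΓD q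
  obtain ⟨r, hr, hNr⟩ := RegularTriangulation.exists_quotient_ge hCk hCk0 hσ hσ1 hΩ hs hΓ hq hq0
  have hlub := isLUB_csSup ⟨0, h0⟩ ⟨_, hub⟩
  set S := sSup (T.dualQuotients ΓD q) with hS
  have hS0 : 0 ≤ S := hlub.1 h0
  refine ⟨S, hlub, ?_, ?_⟩
  · refine (hlub.2 hub).trans ?_
    gcongr
    linarith
  · refine hNr.trans ((mul_le_mul_of_nonneg_left (hlub.1 hr) hC₂0).trans ?_)
    gcongr
    linarith
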